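/- Let $(M,g)$ be a complete, non-compact, connected smooth Riemannian manifold (without boundary) with bounded Ricci curvature, i.e. $-Kg\le \mathrm{Ric}\le Kg$ for some constant $K$, and with polynomial volume growth, i.e. there are a point $p\in M$ and constants $C>0$, $k\ge 1$ such that the geodesic balls satisfy $\mathrm{vol}_g(B_R(p))\le C R^k$ for all $R\ge 1$. Let $V:M\to\mathbb{R}$ be a function of the form $V=-\Delta u$, where $u$ is a smooth function on $M$ with $\sup_M|\nabla u|<\infty$ and $\Delta$ is the Laplace–Beltrami operator. Define $$\lambda_V(g)=\inf\Big\{\int_M\big(4|\nabla w|^2+Vw^2\big)\,dv_g \;:\; w\in H^1(M,g),\ \int_M w^2\,dv_g=1,\ Vw^2\in L^1(M,dv_g)\Big\}\in[-\infty,+\infty],$$ where $H^1(M,g)$ is the space of functions in $L^2(M,dv_g)$ whose weak gradient is in $L^2$. (If $V$ is bounded from below, the condition $Vw^2\in L^1$ only leaves out functions $w$ for which the integral is $+\infty$.) Then $\lambda_V(g)\le 0$. If in addition $V\ge 0$ on $M$, then $\lambda_V(g)=0$. -/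

import Mathlib

open MeasureTheory Bundle
open scoped Manifold ContDiff

noncomputable section

namespace Riem

/-- The model space `ℝⁿ` with its Euclidean structure and Lebesgue measure `volume`. -/
abbrev Model (n : ℕ) : Type := EuclideanSpace ℝ (Fin n)

/-- The `i`-th partial derivative of a function of `n` real variables. -/
def partialDeriv {n : ℕ} (i : Fin n) (f : Model n → ℝ) (y : Model n) : ℝ :=
  fderiv ℝ f y (EuclideanSpace.single i 1)

section Manifold

variable {n : ℕ} {M : Type*} [MetricSpace M] [ChartedSpace (Model n) M]

/-- The `i`-th coordinate vector field `∂_i` of the chart `e`, at the point with coordinates `y`. -/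
def coordVec (e : OpenPartialHomeomorph M (Model n)) (i : Fin n) (y : Model n) :
    TangentSpace (𝓡 n) (e.symm y) :=
  mfderiv (𝓡 n) (𝓡 n) e.symm y (EuclideanSpace.single i 1 : Model n)

variable [RiemannianBundle (fun x : M ↦ TangentSpace (𝓡 n) x)]

/-- The coefficients `g_ij = g(∂_i, ∂_j)` of the metric in the chart `e`. -/
def metricMatrix (e : OpenPartialHomeomorph M (Model n)) (y : Model n) :
    Matrix (Fin n) (Fin n) ℝ :=
  Matrix.of fun i j ↦ inner ℝ (coordVec e i y) (coordVec e j y)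

/-- The Riemannian volume density `√(det g_ij)` in the chart `e`. -/
def volDensity (e : OpenPartialHomeomorph M (Model n)) (y : Model n) : ℝ :=
  √(metricMatrix e y).det

/-- The Laplace-Beltrami operator in the chart `e`:
`(det g)^(-1/2) ∑_i ∂_i ((det g)^(1/2) ∑_j g^{ij} ∂_j u)`, at the point with coordinates `y`. -/
def chartLaplacian (e : OpenPartialHomeomorph M (Model n)) (u : M → ℝ) (y : Model n) : ℝ :=
  (volDensity e y)⁻¹ * ∑ i, partialDeriv i (fun z ↦ volDensity e z *
    ∑ j, (metricMatrix e z)⁻¹ i j * partialDeriv j (u ∘ e.symm) z) y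

/-- `f = Δu`: the function `f` is the Laplacian of `u` for the Riemannian metric, i.e. it is given
by the Laplace-Beltrami formula in every smooth chart. -/
def IsLaplacian (u f : M → ℝ) : Prop :=
  ∀ e ∈ IsManifold.maximalAtlas (𝓡 n) ∞ M, ∀ x ∈ e.source, f x = chartLaplacian e u (e x)

/-- The Christoffel symbols `Γ^k_ij = ½ ∑_l g^{kl} (∂_i g_jl + ∂_j g_il - ∂_l g_ij)`. -/
def christoffel (e : OpenPartialHomeomorph M (Model n)) (k i j : Fin n) (y : Model n) : ℝ :=
  (1 / 2) * ∑ l, (metricMatrix e y)⁻¹ k l *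
    (partialDeriv i (fun z ↦ metricMatrix e z j l) y
      + partialDeriv j (fun z ↦ metricMatrix e z i l) y
      - partialDeriv l (fun z ↦ metricMatrix e z i j) y)

/-- The Ricci tensor in the chart `e`:
`R_ij = ∑_k (∂_k Γ^k_ij - ∂_j Γ^k_ik) + ∑_{k,l} (Γ^k_kl Γ^l_ij - Γ^k_jl Γ^l_ik)`. -/
def ricci (e : OpenPartialHomeomorph M (Model n)) (i j : Fin n) (y : Model n) : ℝ :=
  ∑ k, (partialDeriv k (christoffel e k i j) y - partialDeriv j (christoffel e k i k) y)
    + ∑ k, ∑ l, (christoffel e k k l y * christoffel e l i j y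
        - christoffel e k j l y * christoffel e l i k y)

variable (n M) in
/-- Bounded Ricci curvature: `-K g ≤ Ric ≤ K g` on `M`, for some constant `K`. -/
def BoundedRicci : Prop :=
  ∃ K : ℝ, ∀ e ∈ IsManifold.maximalAtlas (𝓡 n) ∞ M, ∀ y ∈ e.target, ∀ v : Fin n → ℝ,
    |∑ i, ∑ j, ricci e i j y * v i * v j| ≤ K * ∑ i, ∑ j, metricMatrix e y i j * v i * v j

/-- The Riemannian gradient `∇u`: the vector with `g(∇u, w) = du(w)` for every tangent vector `w`
(see `inner_grad`). -/
def grad (u : M → ℝ) (x : M) : TangentSpace (𝓡 n) x :=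
  haveI : FiniteDimensional ℝ (TangentSpace (𝓡 n) x) :=
    inferInstanceAs (FiniteDimensional ℝ (Model n))
  haveI : CompleteSpace (TangentSpace (𝓡 n) x) := FiniteDimensional.complete ℝ _
  (InnerProductSpace.toDual ℝ (TangentSpace (𝓡 n) x)).symm (mfderiv (𝓡 n) 𝓘(ℝ, ℝ) u x)

theorem inner_grad (u : M → ℝ) (x : M) (w : TangentSpace (𝓡 n) x) :
    inner ℝ (grad u x) w = (mfderiv (𝓡 n) 𝓘(ℝ, ℝ) u x w : ℝ) := by
  have : FiniteDimensional ℝ (TangentSpace (𝓡 n) x) :=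
    inferInstanceAs (FiniteDimensional ℝ (Model n))
  have : CompleteSpace (TangentSpace (𝓡 n) x) := FiniteDimensional.complete ℝ _
  exact InnerProductSpace.toDual_symm_apply

variable [MeasurableSpace M]

/-- The Riemannian volume of the domain of the chart `e`, as a measure on `M`: the image under
`e⁻¹` of the measure `√(det g_ij) dy` on the range of `e`. -/
def chartVolume (e : OpenPartialHomeomorph M (Model n)) : Measure M :=
  (((volume : Measure (Model n)).restrict e.target).withDensity
    fun y ↦ ENNReal.ofReal (volDensity e y)).map e.symm

variable (n M) in
/-- The Riemannian volume measure `dv_g`. The measures `chartVolume e` agree on the overlaps of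
the chart domains, and `dv_g` is the measure they glue to, i.e. the least measure which is at
least each of them. -/
def riemannianVolume : Measure M :=
  ⨆ e ∈ IsManifold.maximalAtlas (𝓡 n) ∞ M, chartVolume e

variable (n M) in
/-- Polynomial volume growth of geodesic balls around some point. -/
def PolynomialVolumeGrowth : Prop :=
  ∃ p : M, ∃ C > (0 : ℝ), ∃ k ≥ (1 : ℝ), ∀ R ≥ (1 : ℝ),
    riemannianVolume n M (Metric.ball p R) ≤ ENNReal.ofReal (C * R ^ k)

/-- The (not necessarily continuous) vector field `X` is the weak gradient of `u`: in each chart,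
the functions `g(X, ∂_i)` are the weak partial derivatives of `u`. -/
def IsWeakGradient (u : M → ℝ) (X : ∀ x : M, TangentSpace (𝓡 n) x) : Prop :=
  ∀ e ∈ IsManifold.maximalAtlas (𝓡 n) ∞ M, ∀ i : Fin n,
    LocallyIntegrableOn (u ∘ e.symm) e.target ∧
    LocallyIntegrableOn (fun y ↦ inner ℝ (X (e.symm y)) (coordVec e i y)) e.target ∧
    ∀ ψ : Model n → ℝ, ContDiff ℝ ∞ ψ → HasCompactSupport ψ → tsupport ψ ⊆ e.target →
      ∫ y in e.target, u (e.symm y) * partialDeriv i ψ y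
        = -∫ y in e.target, inner ℝ (X (e.symm y)) (coordVec e i y) * ψ y

/-- `u` belongs to the Sobolev space `H¹(M, g)`, with weak gradient `X`. -/
structure IsH1 (u : M → ℝ) (X : ∀ x : M, TangentSpace (𝓡 n) x) : Prop where
  memLp : MemLp u 2 (riemannianVolume n M)
  memLp_grad : MemLp (fun x ↦ ‖X x‖) 2 (riemannianVolume n M)
  isWeakGradient : IsWeakGradient u X

variable (n) in
/-- The lambda constant `λ_V(g)`: the infimum of `I₀(u) = ∫ (4 |∇u|² + V u²) dv_g` over all
`u ∈ H¹(M, g)` with `∫ u² dv_g = 1`. Functions `u` for which `V u²` is not integrable are left out;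
for `V` bounded from below these are the ones with `I₀(u) = +∞`. -/
def lambdaConst (V : M → ℝ) : EReal :=
  sInf {c : EReal | ∃ (u : M → ℝ) (X : ∀ x : M, TangentSpace (𝓡 n) x),
    IsH1 u X ∧ ∫ x, u x ^ 2 ∂(riemannianVolume n M) = 1 ∧
    Integrable (fun x ↦ V x * u x ^ 2) (riemannianVolume n M) ∧
    c = ((∫ x, (4 * ‖X x‖ ^ 2 + V x * u x ^ 2) ∂(riemannianVolume n M) : ℝ) : EReal)}

end Manifold

end Riem

end

/-! The upper bound comes from testing the functional with cutoffs of large balls. Let `w = c f`,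
where `f` is `1` on `B_R`, vanishes off the closed ball of radius `2R`, is `1/R`-Lipschitz, and `c`
normalizes `∫ w² = 1`. The Dirichlet term is at most `4 (c/R)² vol(B_{4R})`. Since `V = -Δu`,
Green's formula turns the potential term into `∫ ⟨∇u, ∇(w²)⟩`, and `|∇(w²)| ≤ 2c²/R`, so with `|∇u|
≤ G` this term is at most `2 G c² vol(B_{4R}) / R`. No size or sign of `V` enters.

Everything is therefore controlled by `c² vol(B_{4R})`. As `c² vol(B_R) ≤ 1`, a doubling bound
`vol(B_{4R}) ≤ D vol(B_R)` gives `c² vol(B_{4R}) ≤ D`. Polynomial growth yields such a bound, with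
fixed `D`, along arbitrarily large `R` (`exists_doubling_of_polynomial_growth`): otherwise the
volume would outgrow every `C R^k`. Hence `λ_V ≤ D (4 + 2G) / R` for arbitrarily large `R`
(`lambdaConst_le_of_doubling`). If `V ≥ 0`, every competitor has a nonnegative integral.

The analytic input is `green_formula` for compactly supported Lipschitz functions. Completeness
makes closed balls compact (Hopf-Rinow, `properSpace`), so the cutoffs qualify. Read in charts,
Lipschitz functions are locally Lipschitz, their gradients obey the Lipschitz bound
(`norm_grad_le`), and integration by parts holds for them (`setIntegral_partialDeriv_mul`). A
partition of unity passes from charts to `M`. -/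

noncomputable section

namespace Riem

/-! ### Coordinate frames, gradients and smoothness of the metric coefficients. -/

section Charts

variable {n : ℕ} {M : Type*} [MetricSpace M] [ChartedSpace (Model n) M]

theorem mdifferentiable_of_mem_maximalAtlas [IsManifold (𝓡 n) ∞ M]
    {e : OpenPartialHomeomorph M (Model n)}
    (he : e ∈ IsManifold.maximalAtlas (𝓡 n) ∞ M) : e.MDifferentiable (𝓡 n) (𝓡 n) :=
  ⟨(contMDiffOn_of_mem_maximalAtlas he).mdifferentiableOn (by simp),
    (contMDiffOn_symm_of_mem_maximalAtlas he).mdifferentiableOn (by simp)⟩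

theorem mfderiv_symm_apply_eq_sum (e : OpenPartialHomeomorph M (Model n)) (y v : Model n) :
    (mfderiv (𝓡 n) (𝓡 n) e.symm y v : TangentSpace (𝓡 n) (e.symm y))
      = ∑ i, v i • coordVec e i y := by
  have hv : v = ∑ i, v i • (EuclideanSpace.single i 1 : Model n) := by
    ext j; simp [Pi.single_apply]
  conv_lhs => rw [hv]
  exact (map_sum (mfderiv (𝓡 n) (𝓡 n) e.symm y) _ _).trans
    (Finset.sum_congr rfl fun i _ ↦ map_smul (mfderiv (𝓡 n) (𝓡 n) e.symm y) _ _)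

theorem linearIndependent_coordVec [IsManifold (𝓡 n) ∞ M]
    {e : OpenPartialHomeomorph M (Model n)}
    (he : e ∈ IsManifold.maximalAtlas (𝓡 n) ∞ M) {y : Model n} (hy : y ∈ e.target) :
    LinearIndependent ℝ (fun i ↦ coordVec e i y) := by
  have hinj := (mdifferentiable_of_mem_maximalAtlas he).symm.mfderiv_injective hy
  rw [Fintype.linearIndependent_iff]
  intro c hc
  have h1 := mfderiv_symm_apply_eq_sum e y (WithLp.toLp 2 c)
  have h2 : (WithLp.toLp 2 c : Model n) = 0 := by
    apply hinj
    exact (h1.trans hc).trans (map_zero (mfderiv (𝓡 n) (𝓡 n) e.symm y)).symm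
  intro i
  exact congrArg (fun v : Model n ↦ v i) h2

theorem exists_eq_sum_coordVec [IsManifold (𝓡 n) ∞ M]
    {e : OpenPartialHomeomorph M (Model n)}
    (he : e ∈ IsManifold.maximalAtlas (𝓡 n) ∞ M) {y : Model n} (hy : y ∈ e.target)
    (X : TangentSpace (𝓡 n) (e.symm y)) :
    ∃ a : Fin n → ℝ, X = ∑ i, a i • coordVec e i y := by
  obtain ⟨v, hv⟩ := (mdifferentiable_of_mem_maximalAtlas he).symm.mfderiv_surjective hy X
  exact ⟨fun i ↦ (show Model n from v) i, hv.symm.trans (mfderiv_symm_apply_eq_sum e y v)⟩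

theorem mdifferentiableAt_symm_iff [IsManifold (𝓡 n) ∞ M]
    {e : OpenPartialHomeomorph M (Model n)}
    (he : e ∈ IsManifold.maximalAtlas (𝓡 n) ∞ M) {y : Model n} (hy : y ∈ e.target) {f : M → ℝ} :
    MDifferentiableAt (𝓡 n) 𝓘(ℝ, ℝ) f (e.symm y) ↔ DifferentiableAt ℝ (f ∘ e.symm) y := by
  have hd := mdifferentiable_of_mem_maximalAtlas he
  constructor
  · intro h
    exact (h.comp y (hd.mdifferentiableAt_symm hy)).differentiableAt
  · intro h
    have h1 : MDifferentiableAt (𝓡 n) 𝓘(ℝ, ℝ) ((f ∘ e.symm) ∘ e) (e.symm y) := by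
      refine MDifferentiableAt.comp (I' := 𝓡 n) (e.symm y) ?_
        (hd.mdifferentiableAt (e.map_target hy))
      rw [e.right_inv hy]
      exact h.mdifferentiableAt
    refine h1.congr_of_eventuallyEq ?_
    filter_upwards [e.open_source.mem_nhds (e.map_target hy)] with x hx
    simp [e.left_inv hx]

/-- Chain rule where `f` is differentiable. Elsewhere both derivatives take the default value `0`,
so the coordinate formulas for gradients hold at every point and not only almost everywhere. -/
theorem mfderiv_coordVec [IsManifold (𝓡 n) ∞ M]
    {e : OpenPartialHomeomorph M (Model n)}
    (he : e ∈ IsManifold.maximalAtlas (𝓡 n) ∞ M) {y : Model n} (hy : y ∈ e.target) (f : M → ℝ)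
    (i : Fin n) :
    (mfderiv (𝓡 n) 𝓘(ℝ, ℝ) f (e.symm y) (coordVec e i y) : ℝ)
      = partialDeriv i (f ∘ e.symm) y := by
  have hd := mdifferentiable_of_mem_maximalAtlas he
  by_cases h : MDifferentiableAt (𝓡 n) 𝓘(ℝ, ℝ) f (e.symm y)
  · have h1 := mfderiv_comp y h (hd.mdifferentiableAt_symm hy)
    rw [mfderiv_eq_fderiv] at h1
    rw [partialDeriv, h1]
    rfl
  · rw [mfderiv_zero_of_not_mdifferentiableAt h, partialDeriv,
      fderiv_zero_of_not_differentiableAt (mt (mdifferentiableAt_symm_iff he hy).2 h)]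
    rfl

/-- The frame field is the tangent map of `e.symm` applied to a constant section of the tangent
bundle of `ℝⁿ`; smoothness of the metric coefficients rests on this. -/
theorem contMDiffOn_coordVec [IsManifold (𝓡 n) ∞ M]
    {e : OpenPartialHomeomorph M (Model n)}
    (he : e ∈ IsManifold.maximalAtlas (𝓡 n) ∞ M) (i : Fin n) :
    ContMDiffOn (𝓡 n) (𝓡 n).tangent ∞
      (fun y ↦ (⟨e.symm y, coordVec e i y⟩ : TangentBundle (𝓡 n) M)) e.target := by
  have h1 := (contMDiffOn_symm_of_mem_maximalAtlas he).contMDiffOn_tangentMapWithin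
    (m := ∞) (by simp) e.open_target.uniqueMDiffOn
  have h2 : ContMDiff (𝓡 n) (𝓡 n).tangent ∞ (fun y : Model n ↦
      (⟨y, (EuclideanSpace.single i 1 : Model n)⟩ : TangentBundle (𝓡 n) (Model n))) := by
    intro y
    exact contMDiffAt_vectorSpace_iff_contDiffAt.2 contDiffAt_const
  refine (h1.comp h2.contMDiffOn (fun y hy ↦ hy)).congr fun y hy ↦ ?_
  simp only [Function.comp, tangentMapWithin, coordVec]
  rw [mfderivWithin_of_isOpen e.open_target hy]

variable [RiemannianBundle (fun x : M ↦ TangentSpace (𝓡 n) x)]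

theorem metricMatrix_posDef [IsManifold (𝓡 n) ∞ M]
    {e : OpenPartialHomeomorph M (Model n)}
    (he : e ∈ IsManifold.maximalAtlas (𝓡 n) ∞ M) {y : Model n} (hy : y ∈ e.target) :
    (metricMatrix e y).PosDef :=
  Matrix.posDef_gram_of_linearIndependent (linearIndependent_coordVec he hy)

theorem volDensity_pos [IsManifold (𝓡 n) ∞ M]
    {e : OpenPartialHomeomorph M (Model n)}
    (he : e ∈ IsManifold.maximalAtlas (𝓡 n) ∞ M) {y : Model n} (hy : y ∈ e.target) :
    0 < volDensity e y :=
  Real.sqrt_pos.2 (metricMatrix_posDef he hy).det_pos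

theorem inner_grad_coordVec [IsManifold (𝓡 n) ∞ M]
    {e : OpenPartialHomeomorph M (Model n)}
    (he : e ∈ IsManifold.maximalAtlas (𝓡 n) ∞ M) {y : Model n} (hy : y ∈ e.target) (f : M → ℝ)
    (i : Fin n) :
    inner ℝ (grad f (e.symm y)) (coordVec e i y) = partialDeriv i (f ∘ e.symm) y :=
  (inner_grad f _ _).trans (mfderiv_coordVec he hy f i)

/-- The inner product of gradients in a chart. -/
theorem inner_grad_grad [IsManifold (𝓡 n) ∞ M]
    {e : OpenPartialHomeomorph M (Model n)}
    (he : e ∈ IsManifold.maximalAtlas (𝓡 n) ∞ M) {y : Model n} (hy : y ∈ e.target) (f h : M → ℝ) :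
    inner ℝ (grad (n := n) f (e.symm y)) (grad h (e.symm y)) =
      ∑ i, (∑ j, (metricMatrix e y)⁻¹ i j * partialDeriv j (f ∘ e.symm) y)
        * partialDeriv i (h ∘ e.symm) y := by
  obtain ⟨a, ha⟩ := exists_eq_sum_coordVec he hy (grad f (e.symm y))
  have hf : (fun j ↦ partialDeriv j (f ∘ e.symm) y) = (metricMatrix e y).mulVec a := by
    funext j
    rw [← inner_grad_coordVec he hy f j, ha, sum_inner, Matrix.mulVec, dotProduct]
    refine Finset.sum_congr rfl fun i _ ↦ ?_
    rw [inner_smul_left, real_inner_comm, mul_comm]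
    rfl
  have hinv : (metricMatrix e y)⁻¹.mulVec (fun j ↦ partialDeriv j (f ∘ e.symm) y) = a := by
    rw [hf, Matrix.mulVec_mulVec, Matrix.nonsing_inv_mul _
      (metricMatrix_posDef he hy).det_pos.ne'.isUnit, Matrix.one_mulVec]
  conv_lhs => rw [ha, sum_inner]
  refine Finset.sum_congr rfl fun i _ ↦ ?_
  rw [inner_smul_left, real_inner_comm, inner_grad_coordVec he hy, ← hinv]
  rfl

variable [IsManifold (𝓡 n) ∞ M] [IsContMDiffRiemannianBundle (𝓡 n) ∞ (Model n)
      (fun x : M ↦ TangentSpace (𝓡 n) x)]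

theorem contDiffOn_metricMatrix {e : OpenPartialHomeomorph M (Model n)}
    (he : e ∈ IsManifold.maximalAtlas (𝓡 n) ∞ M) (i j : Fin n) :
    ContDiffOn ℝ ∞ (fun y ↦ metricMatrix e y i j) e.target := by
  rw [← contMDiffOn_iff_contDiffOn]
  exact ContMDiffOn.inner_bundle (contMDiffOn_coordVec he i) (contMDiffOn_coordVec he j)

theorem contDiffOn_det_metricMatrix {e : OpenPartialHomeomorph M (Model n)}
    (he : e ∈ IsManifold.maximalAtlas (𝓡 n) ∞ M) :
    ContDiffOn ℝ ∞ (fun y ↦ (metricMatrix e y).det) e.target := by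
  simp only [Matrix.det_apply]
  refine ContDiffOn.sum fun σ _ ↦ ContDiffOn.const_smul _ ?_
  exact contDiffOn_prod fun i _ ↦ contDiffOn_metricMatrix he _ _

theorem contDiffOn_volDensity {e : OpenPartialHomeomorph M (Model n)}
    (he : e ∈ IsManifold.maximalAtlas (𝓡 n) ∞ M) :
    ContDiffOn ℝ ∞ (volDensity e) e.target :=
  (contDiffOn_det_metricMatrix he).sqrt fun _ hy ↦ (metricMatrix_posDef he hy).det_pos.ne'

theorem contDiffOn_metricMatrix_inv {e : OpenPartialHomeomorph M (Model n)}
    (he : e ∈ IsManifold.maximalAtlas (𝓡 n) ∞ M) (i j : Fin n) :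
    ContDiffOn ℝ ∞ (fun y ↦ (metricMatrix e y)⁻¹ i j) e.target := by
  simp only [Matrix.inv_def, Ring.inverse_eq_inv', Matrix.smul_apply, smul_eq_mul]
  refine ((contDiffOn_det_metricMatrix he).inv fun _ hy ↦
    (metricMatrix_posDef he hy).det_pos.ne').mul ?_
  -- Cramer's rule: each adjugate entry is a polynomial in the metric coefficients.
  simp only [Matrix.adjugate_apply, Matrix.det_apply]
  refine ContDiffOn.sum fun σ _ ↦ ContDiffOn.const_smul _ ?_
  refine contDiffOn_prod fun k _ ↦ ?_
  by_cases h : σ k = j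
  · simp only [h, Matrix.updateRow_self]; exact contDiffOn_const
  · simp only [Matrix.updateRow_ne h]; exact contDiffOn_metricMatrix he _ _

end Charts

/-! ### The Riemannian volume: compatibility of charts, gluing, integration in a chart. -/

section Volume

variable {n : ℕ} {M : Type*} [MetricSpace M]

theorem measurableSet_target_inter_preimage [MeasurableSpace M] [BorelSpace M]
    (e : OpenPartialHomeomorph M (Model n)) {s : Set M} (hs : MeasurableSet s) :
    MeasurableSet (e.target ∩ e.symm ⁻¹' s) := by
  have h := (continuousOn_iff_continuous_domRestrict.1 e.continuousOn_symm).measurable hs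
  have h2 := e.open_target.measurableSet.subtype_image h
  convert h2 using 1
  ext y
  simp [and_comm]

theorem measurableSet_source_inter_preimage [MeasurableSpace M] [BorelSpace M]
    (e : OpenPartialHomeomorph M (Model n)) {s : Set (Model n)} (hs : MeasurableSet s) :
    MeasurableSet (e.source ∩ e ⁻¹' s) := by
  have h := (continuousOn_iff_continuous_domRestrict.1 e.continuousOn).measurable hs
  have h2 := e.open_source.measurableSet.subtype_image h
  convert h2 using 1
  ext y
  simp [and_comm]

variable [ChartedSpace (Model n) M]

variable (n) in
theorem exists_countable_chart_cover [SecondCountableTopology M] :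
    ∃ s : Set M, s.Countable ∧ ⋃ x ∈ s, (chartAt (Model n) x).source = Set.univ :=
  TopologicalSpace.countable_cover_nhds fun x ↦ chart_source_mem_nhds (Model n) x

theorem contDiffAt_transition [IsManifold (𝓡 n) ∞ M] {e e' : OpenPartialHomeomorph M (Model n)}
    (he : e ∈ IsManifold.maximalAtlas (𝓡 n) ∞ M) (he' : e' ∈ IsManifold.maximalAtlas (𝓡 n) ∞ M)
    {y : Model n} (hy : y ∈ e.target) (hy' : e.symm y ∈ e'.source) :
    ContDiffAt ℝ ∞ (e' ∘ e.symm) y :=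
  ((contMDiffAt_of_mem_maximalAtlas he' hy').comp y
    (contMDiffAt_symm_of_mem_maximalAtlas he hy)).contDiffAt

theorem mfderiv_symm_transition [IsManifold (𝓡 n) ∞ M] {e e' : OpenPartialHomeomorph M (Model n)}
    (he : e ∈ IsManifold.maximalAtlas (𝓡 n) ∞ M) (he' : e' ∈ IsManifold.maximalAtlas (𝓡 n) ∞ M)
    {y : Model n} (hy : y ∈ e.target) (hy' : e.symm y ∈ e'.source) (v : Model n) :
    (mfderiv (𝓡 n) (𝓡 n) e.symm y v : Model n) =
      (mfderiv (𝓡 n) (𝓡 n) e'.symm (e' (e.symm y)) (fderiv ℝ (e' ∘ e.symm) y v : Model n) :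
        Model n) := by
  have hd := mdifferentiable_of_mem_maximalAtlas he'
  have h1 := mfderiv_comp (I := 𝓡 n) (I' := 𝓡 n) (I'' := 𝓡 n) y (g := e'.symm) (f := e' ∘ e.symm)
    (hd.mdifferentiableAt_symm (e'.map_source hy'))
    ((contDiffAt_transition he he' hy hy').differentiableAt (by simp)).mdifferentiableAt
  have h2 : e'.symm ∘ (e' ∘ e.symm) =ᶠ[nhds y] e.symm := by
    filter_upwards [e.symm.continuousAt hy (e'.open_source.mem_nhds hy')] with z hz
    exact e'.left_inv hz
  have h3 : (mfderiv (𝓡 n) (𝓡 n) (e'.symm ∘ (e' ∘ e.symm)) y v : Model n) =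
      mfderiv (𝓡 n) (𝓡 n) e.symm y v := by rw [h2.mfderiv_eq]; rfl
  rw [← h3, h1, mfderiv_eq_fderiv]
  rfl

variable [RiemannianBundle (fun x : M ↦ TangentSpace (𝓡 n) x)]

/-- Gram matrices transform by congruence under a change of frame, here by the Jacobian of the
transition map. -/
theorem metricMatrix_transition [IsManifold (𝓡 n) ∞ M] {e e' : OpenPartialHomeomorph M (Model n)}
    (he : e ∈ IsManifold.maximalAtlas (𝓡 n) ∞ M) (he' : e' ∈ IsManifold.maximalAtlas (𝓡 n) ∞ M)
    {y : Model n} (hy : y ∈ e.target) (hy' : e.symm y ∈ e'.source) :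
    metricMatrix e y =
      (LinearMap.toMatrix (EuclideanSpace.basisFun (Fin n) ℝ).toBasis
        (EuclideanSpace.basisFun (Fin n) ℝ).toBasis (fderiv ℝ (e' ∘ e.symm) y).toLinearMap).transpose
      * metricMatrix e' (e' (e.symm y)) *
      LinearMap.toMatrix (EuclideanSpace.basisFun (Fin n) ℝ).toBasis
        (EuclideanSpace.basisFun (Fin n) ℝ).toBasis (fderiv ℝ (e' ∘ e.symm) y).toLinearMap := by
  -- The two frames live in fibres over points that are equal only propositionally; this transports
  -- the inner product from one fibre to the other.
  have key : ∀ (x : M), x = e'.symm (e' (e.symm y)) → ∀ v w : TangentSpace (𝓡 n) x,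
      ∀ v' w' : TangentSpace (𝓡 n) (e'.symm (e' (e.symm y))), (v : Model n) = v' →
      (w : Model n) = w' → inner ℝ v w = inner ℝ v' w' := by
    rintro x rfl v w _ _ rfl rfl; rfl
  have hx : e.symm y = e'.symm (e' (e.symm y)) := (e'.left_inv hy').symm
  ext i j
  have hi : ∀ i, (coordVec e i y : Model n) = (∑ k, (fderiv ℝ (e' ∘ e.symm) y
      (EuclideanSpace.single i 1)) k • coordVec e' k (e' (e.symm y)) :
      TangentSpace (𝓡 n) (e'.symm (e' (e.symm y)))) := fun i ↦
    (mfderiv_symm_transition he he' hy hy' _).trans (mfderiv_symm_apply_eq_sum e' _ _)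
  refine (key _ hx _ _ _ _ (hi i) (hi j)).trans ?_
  simp only [sum_inner, inner_sum, Matrix.mul_apply, Finset.sum_mul, inner_smul_left,
    inner_smul_right, Matrix.transpose_apply, LinearMap.toMatrix_apply]
  refine Finset.sum_congr rfl fun k _ ↦ ?_
  rw [Finset.mul_sum]
  refine Finset.sum_congr rfl fun l _ ↦ ?_
  simp [metricMatrix]
  ring

theorem volDensity_transition [IsManifold (𝓡 n) ∞ M] {e e' : OpenPartialHomeomorph M (Model n)}
    (he : e ∈ IsManifold.maximalAtlas (𝓡 n) ∞ M) (he' : e' ∈ IsManifold.maximalAtlas (𝓡 n) ∞ M)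
    {y : Model n} (hy : y ∈ e.target) (hy' : e.symm y ∈ e'.source) :
    volDensity e y = |(fderiv ℝ (e' ∘ e.symm) y).det| * volDensity e' (e' (e.symm y)) := by
  rw [volDensity, metricMatrix_transition he he' hy hy', Matrix.det_mul, Matrix.det_mul,
    Matrix.det_transpose, LinearMap.det_toMatrix, volDensity]
  have : ∀ a b : ℝ, a * b * a = a ^ 2 * b := fun a b ↦ by ring
  rw [this, Real.sqrt_mul (sq_nonneg _), Real.sqrt_sq_eq_abs]

theorem aemeasurable_symm [MeasurableSpace M] [BorelSpace M]
    (e : OpenPartialHomeomorph M (Model n)) :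
    AEMeasurable e.symm (((volume : Measure (Model n)).restrict e.target).withDensity
      fun y ↦ ENNReal.ofReal (volDensity e y)) :=
  (e.continuousOn_symm.aemeasurable e.open_target.measurableSet).mono_ac
    (withDensity_absolutelyContinuous _ _)

theorem chartVolume_apply [MeasurableSpace M] [BorelSpace M]
    (e : OpenPartialHomeomorph M (Model n)) {s : Set M} (hs : MeasurableSet s) :
    chartVolume e s = ∫⁻ y in e.target ∩ e.symm ⁻¹' s, ENNReal.ofReal (volDensity e y) := by
  rw [chartVolume, Measure.map_apply_of_aemeasurable (aemeasurable_symm e) hs,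
    ← restrict_withDensity e.open_target.measurableSet,
    Measure.restrict_apply' e.open_target.measurableSet, Set.inter_comm,
    withDensity_apply _ (measurableSet_target_inter_preimage e hs)]

variable [IsManifold (𝓡 n) ∞ M]

/-- Change of variables along the transition map: its Jacobian is exactly the factor relating the
two densities. -/
theorem chartVolume_eq_of_subset [MeasurableSpace M] [BorelSpace M]
    {e e' : OpenPartialHomeomorph M (Model n)}
    (he : e ∈ IsManifold.maximalAtlas (𝓡 n) ∞ M) (he' : e' ∈ IsManifold.maximalAtlas (𝓡 n) ∞ M)
    {s : Set M} (hs : MeasurableSet s) (hse : s ⊆ e.source) (hse' : s ⊆ e'.source) :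
    chartVolume e s = chartVolume e' s := by
  rw [chartVolume_apply e hs, chartVolume_apply e' hs]
  have himg : e'.target ∩ e'.symm ⁻¹' s = (e' ∘ e.symm) '' (e.target ∩ e.symm ⁻¹' s) := by
    ext y
    constructor
    · rintro ⟨hy, hys⟩
      refine ⟨e (e'.symm y), ⟨e.map_source (hse hys), ?_⟩, ?_⟩
      · simpa [e.left_inv (hse hys)] using hys
      · simp [e.left_inv (hse hys), e'.right_inv hy]
    · rintro ⟨z, ⟨hz, hzs⟩, rfl⟩
      refine ⟨e'.map_source (hse' hzs), ?_⟩
      simpa [e'.left_inv (hse' hzs)] using hzs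
  rw [himg, lintegral_image_eq_lintegral_abs_det_fderiv_mul volume
    (measurableSet_target_inter_preimage e hs) (f' := fun y ↦ fderiv ℝ (e' ∘ e.symm) y)]
  · refine setLIntegral_congr_fun (measurableSet_target_inter_preimage e hs) fun y hy ↦ ?_
    simp only [Function.comp]
    rw [← ENNReal.ofReal_mul (abs_nonneg _)]
    exact congrArg _ (volDensity_transition he he' hy.1 (hse' hy.2))
  · intro y hy
    exact ((contDiffAt_transition he he' hy.1 (hse' hy.2)).differentiableAt
      (by simp)).hasFDerivAt.hasFDerivWithinAt
  · intro y hy z hz hyz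
    have h1 := e'.injOn (hse' hy.2) (hse' hz.2) hyz
    exact e.symm.injOn hy.1 hz.1 h1

theorem riemannianVolume_apply_of_subset [MeasurableSpace M] [BorelSpace M]
    {e : OpenPartialHomeomorph M (Model n)}
    (he : e ∈ IsManifold.maximalAtlas (𝓡 n) ∞ M)
    {s : Set M} (hs : MeasurableSet s) (hse : s ⊆ e.source) :
    riemannianVolume n M s = chartVolume e s := by
  apply le_antisymm
  -- The right side dominates every chart volume: inside `e.source` the chart volumes agree on
  -- overlaps, and outside it the measure is as large as possible. So it dominates the supremum, and
  -- on `s` the second term vanishes.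
  · have h : riemannianVolume n M ≤ chartVolume e + (⊤ : Measure M).restrict e.sourceᶜ := by
      refine iSup₂_le fun e' he' ↦ Measure.le_iff.2 fun t ht ↦ ?_
      have hm := e.open_source.measurableSet
      rw [← measure_inter_add_sdiff t hm, Measure.add_apply]
      refine add_le_add ?_ ?_
      · have h0 : chartVolume e' (t ∩ e.source) = chartVolume e' (t ∩ e.source ∩ e'.source) := by
          rw [chartVolume_apply e' (ht.inter hm),
            chartVolume_apply e' ((ht.inter hm).inter e'.open_source.measurableSet)]
          congr 2
          ext y
          simp only [Set.mem_inter_iff, Set.mem_preimage]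
          exact ⟨fun h ↦ ⟨h.1, h.2, e'.map_target h.1⟩, fun h ↦ ⟨h.1, h.2.1⟩⟩
        rw [h0, chartVolume_eq_of_subset he' he
          ((ht.inter hm).inter e'.open_source.measurableSet) Set.inter_subset_right
          (Set.inter_subset_left.trans Set.inter_subset_right)]
        exact measure_mono (Set.inter_subset_left.trans Set.inter_subset_left)
      · rw [Measure.restrict_apply ht, ← Set.sdiff_eq]
        exact le_top (α := Measure M) (a := chartVolume e') _
    refine (h s).trans ?_
    rw [Measure.add_apply, Measure.restrict_apply hs, ← Set.sdiff_eq, Set.sdiff_eq_empty.2 hse]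
    simp
  · exact (le_iSup₂_of_le (f := fun e (_ : e ∈ IsManifold.maximalAtlas (𝓡 n) ∞ M) ↦ chartVolume e)
      e he le_rfl) s

theorem riemannianVolume_restrict_source [MeasurableSpace M] [BorelSpace M]
    {e : OpenPartialHomeomorph M (Model n)}
    (he : e ∈ IsManifold.maximalAtlas (𝓡 n) ∞ M) :
    (riemannianVolume n M).restrict e.source = chartVolume e := by
  ext s hs
  rw [Measure.restrict_apply hs, riemannianVolume_apply_of_subset he
    (hs.inter e.open_source.measurableSet) Set.inter_subset_right,
    chartVolume_apply e (hs.inter e.open_source.measurableSet), chartVolume_apply e hs]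
  congr 2
  ext y
  simp only [Set.mem_inter_iff, Set.mem_preimage]
  exact ⟨fun h ↦ ⟨h.1, h.2.1⟩, fun h ↦ ⟨h.1, h.2, e.map_target h.1⟩⟩

theorem ae_restrict_source_of_ae [MeasurableSpace M] [BorelSpace M]
    {e : OpenPartialHomeomorph M (Model n)}
    (he : e ∈ IsManifold.maximalAtlas (𝓡 n) ∞ M) {P : M → Prop}
    (h : ∀ᵐ y ∂(volume : Measure (Model n)).restrict e.target, P (e.symm y)) :
    ∀ᵐ x ∂(riemannianVolume n M).restrict e.source, P x := by
  obtain ⟨N, hN, hNm, hN0⟩ := exists_measurable_superset_of_null (ae_iff.1 h)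
  rw [riemannianVolume_restrict_source he, ae_iff]
  have hm := measurableSet_source_inter_preimage e hNm
  have h1 : chartVolume e (e.source ∩ e ⁻¹' N) = 0 := by
    rw [chartVolume_apply e hm]
    refine setLIntegral_measure_zero _ _ (measure_mono_null (t := e.target ∩ N) ?_ ?_)
    · rintro y ⟨hy, -, hy2⟩
      simp only [Set.mem_preimage, e.right_inv hy] at hy2
      exact ⟨hy, hy2⟩
    · rwa [Measure.restrict_apply hNm, Set.inter_comm] at hN0
  have h2 : chartVolume e e.sourceᶜ = 0 := by
    rw [chartVolume_apply e e.open_source.measurableSet.compl]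
    refine setLIntegral_measure_zero _ _ (measure_mono_null (t := ∅) ?_ measure_empty)
    rintro y ⟨hy, hy2⟩
    exact hy2 (e.map_target hy)
  refine measure_mono_null ?_ (measure_union_null h1 h2)
  intro x hx
  by_cases hxs : x ∈ e.source
  · refine Or.inl ⟨hxs, hN ?_⟩
    simpa [e.left_inv hxs] using hx
  · exact Or.inr hxs

theorem aestronglyMeasurable_restrict_source [MeasurableSpace M] [BorelSpace M]
    {e : OpenPartialHomeomorph M (Model n)}
    (he : e ∈ IsManifold.maximalAtlas (𝓡 n) ∞ M) {f : M → ℝ}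
    (h : AEStronglyMeasurable (f ∘ e.symm) ((volume : Measure (Model n)).restrict e.target)) :
    AEStronglyMeasurable f ((riemannianVolume n M).restrict e.source) := by
  have h1 : AEMeasurable (h.mk _ ∘ e) ((riemannianVolume n M).restrict e.source) :=
    h.stronglyMeasurable_mk.measurable.comp_aemeasurable
      (e.continuousOn.aemeasurable e.open_source.measurableSet)
  refine h1.aestronglyMeasurable.congr (ae_restrict_source_of_ae he ?_)
  filter_upwards [h.ae_eq_mk, ae_restrict_mem e.open_target.measurableSet] with y hy hyt
  simp only [Function.comp, e.right_inv hyt]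
  exact hy.symm

/-- Second countability reduces to countably many charts, in each of which null sets correspond to
Lebesgue null sets. -/
theorem ae_of_forall_chart [SecondCountableTopology M] [MeasurableSpace M] [BorelSpace M]
    {P : M → Prop}
    (h : ∀ e ∈ IsManifold.maximalAtlas (𝓡 n) ∞ M,
      ∀ᵐ y ∂(volume : Measure (Model n)).restrict e.target, P (e.symm y)) :
    ∀ᵐ x ∂riemannianVolume n M, P x := by
  obtain ⟨s, hs, hsu⟩ := exists_countable_chart_cover n (M := M)
  rw [← Measure.restrict_univ (μ := riemannianVolume n M), ← hsu, ae_restrict_biUnion_iff _ hs]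
  intro x _
  exact ae_restrict_source_of_ae (IsManifold.chart_mem_maximalAtlas x)
    (h _ (IsManifold.chart_mem_maximalAtlas x))

theorem aestronglyMeasurable_of_forall_chart [SecondCountableTopology M] [MeasurableSpace M]
    [BorelSpace M] {f : M → ℝ}
    (h : ∀ e ∈ IsManifold.maximalAtlas (𝓡 n) ∞ M,
      AEStronglyMeasurable (f ∘ e.symm) ((volume : Measure (Model n)).restrict e.target)) :
    AEStronglyMeasurable f (riemannianVolume n M) := by
  obtain ⟨s, hs, hsu⟩ := exists_countable_chart_cover n (M := M)
  rw [← Measure.restrict_univ (μ := riemannianVolume n M), ← hsu, Set.biUnion_eq_iUnion]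
  have := hs.to_subtype
  rw [aestronglyMeasurable_iUnion_iff]
  intro x
  exact aestronglyMeasurable_restrict_source (IsManifold.chart_mem_maximalAtlas x.1)
    (h _ (IsManifold.chart_mem_maximalAtlas x.1))

variable [IsContMDiffRiemannianBundle (𝓡 n) ∞ (Model n) (fun x : M ↦ TangentSpace (𝓡 n) x)]

theorem setIntegral_source_eq [MeasurableSpace M] [BorelSpace M]
    {e : OpenPartialHomeomorph M (Model n)}
    (he : e ∈ IsManifold.maximalAtlas (𝓡 n) ∞ M) {f : M → ℝ}
    (hf : AEStronglyMeasurable f (riemannianVolume n M)) :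
    ∫ x in e.source, f x ∂riemannianVolume n M
      = ∫ y in e.target, volDensity e y * f (e.symm y) := by
  have hf' := hf.restrict (s := e.source)
  rw [riemannianVolume_restrict_source he] at hf' ⊢
  rw [chartVolume, integral_map (aemeasurable_symm e) hf',
    integral_withDensity_eq_integral_toReal_smul₀]
  · refine setIntegral_congr_fun e.open_target.measurableSet fun y hy ↦ ?_
    simp [ENNReal.toReal_ofReal (volDensity_pos he hy).le]
  · exact ((contDiffOn_volDensity he).continuousOn.aemeasurable
      e.open_target.measurableSet).ennreal_ofReal
  · simp

/-- In a chart this is the integral of a positive density over a nonempty open set. It makes the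
cutoffs normalizable. -/
theorem riemannianVolume_pos_of_isOpen [MeasurableSpace M] [BorelSpace M]
    {s : Set M} (hs : IsOpen s) (hne : s.Nonempty) : 0 < riemannianVolume n M s := by
  obtain ⟨x, hx⟩ := hne
  set e := chartAt (Model n) x with hedef
  have he : e ∈ IsManifold.maximalAtlas (𝓡 n) ∞ M := IsManifold.chart_mem_maximalAtlas x
  have hxe : x ∈ e.source := mem_chart_source _ x
  have ho : IsOpen (e.target ∩ e.symm ⁻¹' s) := e.symm.isOpen_inter_preimage hs
  have hne : (e.target ∩ e.symm ⁻¹' s).Nonempty :=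
    ⟨e x, e.map_source hxe, by simpa [e.left_inv hxe] using hx⟩
  refine lt_of_lt_of_le ?_ (measure_mono (Set.inter_subset_left (t := e.source)))
  rw [riemannianVolume_apply_of_subset he (hs.inter e.open_source).measurableSet
    Set.inter_subset_right, chartVolume_apply e (hs.inter e.open_source).measurableSet]
  have heq : e.target ∩ e.symm ⁻¹' (s ∩ e.source) = e.target ∩ e.symm ⁻¹' s := by
    ext y
    simp only [Set.mem_inter_iff, Set.mem_preimage]
    exact ⟨fun h ↦ ⟨h.1, h.2.1⟩, fun h ↦ ⟨h.1, h.2, e.map_target h.1⟩⟩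
  rw [heq, pos_iff_ne_zero]
  intro h0
  have hm : AEMeasurable (fun y ↦ ENNReal.ofReal (volDensity e y))
      ((volume : Measure (Model n)).restrict (e.target ∩ e.symm ⁻¹' s)) :=
    (((contDiffOn_volDensity he).continuousOn.mono Set.inter_subset_left).aemeasurable
      ho.measurableSet).ennreal_ofReal
  have h1 : ∀ᵐ y ∂(volume : Measure (Model n)).restrict (e.target ∩ e.symm ⁻¹' s), False := by
    filter_upwards [(lintegral_eq_zero_iff' hm).1 h0, ae_restrict_mem ho.measurableSet] with y h2 h3
    simp only [Pi.zero_apply, ENNReal.ofReal_eq_zero] at h2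
    exact absurd (volDensity_pos he h3.1) h2.not_gt
  rw [Filter.eventually_false_iff_eq_bot, ae_eq_bot, Measure.restrict_eq_zero] at h1
  exact (ho.measure_pos volume hne).ne' h1

end Volume

/-! ### Compactness of closed balls in a complete Riemannian manifold. -/

section HopfRinow

/-- **Hopf-Rinow theorem**: a complete locally compact length space is proper. -/
theorem properSpace_of_length {X : Type*} [MetricSpace X] [CompleteSpace X] [LocallyCompactSpace X]
    (hlen : ∀ (x y : X) (r s : ℝ), 0 < r → 0 < s → dist x y < r + s →
      ∃ z, dist x z < r ∧ dist z y < s) : ProperSpace X := by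
  refine ⟨fun p ↦ ?_⟩
  by_contra! hcon
  obtain ⟨R₀, hR₀⟩ := hcon
  -- If some ball fails to be compact, the compact radii are bounded. Their supremum `R` is shown to
  -- be attained and then to be exceeded, a contradiction.
  set S : Set ℝ := {r | 0 ≤ r ∧ IsCompact (Metric.closedBall p r)} with hS
  have h0 : (0 : ℝ) ∈ S := ⟨le_rfl, by simp⟩
  have hbdd : BddAbove S := by
    refine ⟨R₀, fun r hr ↦ ?_⟩
    by_contra! hlt
    exact hR₀ (hr.2.of_isClosed_subset Metric.isClosed_closedBall
      (Metric.closedBall_subset_closedBall hlt.le))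
  set R := sSup S
  have hR0 : 0 ≤ R := le_csSup hbdd h0
  have hlt : ∀ r < R, IsCompact (Metric.closedBall p r) := by
    intro r hr
    obtain ⟨r', hr', hrr'⟩ := exists_lt_of_lt_csSup ⟨0, h0⟩ hr
    exact hr'.2.of_isClosed_subset Metric.isClosed_closedBall
      (Metric.closedBall_subset_closedBall hrr'.le)
  have hR : IsCompact (Metric.closedBall p R) := by
    refine TotallyBounded.isCompact_of_isClosed ?_ Metric.isClosed_closedBall
    rw [Metric.totallyBounded_iff]
    intro ε hε
    by_cases hRε : R < ε
    · exact ⟨{p}, Set.finite_singleton p, fun x hx ↦ by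
        simpa using (Metric.mem_closedBall.1 hx).trans_lt hRε⟩
    -- Since `R < (R - ε/4) + ε/2`, the length property puts each point of the `R`-ball within `ε/2`
    -- of the compact ball of radius `R - ε/4`, so a finite `ε/2`-net of the latter is an `ε`-net of
    -- the former.
    · have hc := hlt (R - ε / 4) (by linarith)
      obtain ⟨t, ht, hcov⟩ := Metric.totallyBounded_iff.1 hc.totallyBounded (ε / 2) (by linarith)
      refine ⟨t, ht, fun x hx ↦ ?_⟩
      obtain ⟨z, hz1, hz2⟩ := hlen p x (R - ε / 4) (ε / 2) (by linarith) (by linarith) (by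
        rw [dist_comm]; linarith [Metric.mem_closedBall.1 hx])
      have hz := hcov (Metric.mem_closedBall'.2 hz1.le)
      simp only [Set.mem_iUnion, Metric.mem_ball] at hz ⊢
      obtain ⟨y, hy, hzy⟩ := hz
      refine ⟨y, hy, ?_⟩
      have := dist_triangle x z y
      rw [dist_comm x z] at this
      linarith
  -- Local compactness gives a compact thickening of the `R`-ball; by the length property it
  -- contains the ball of radius `R + δ/2`.
  obtain ⟨δ, hδ, hδc⟩ := hR.exists_isCompact_cthickening
  have hmem : R + δ / 2 ∈ S := by
    refine ⟨by linarith, hδc.of_isClosed_subset Metric.isClosed_closedBall fun x hx ↦ ?_⟩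
    rw [Metric.mem_closedBall'] at hx
    -- The length property needs positive radii, so `R = 0` is separate: there the centre serves as
    -- the nearby point.
    rcases hR0.eq_or_lt with h | h
    · exact Metric.mem_cthickening_of_dist_le x p δ _ (Metric.mem_closedBall_self hR0)
        (by rw [dist_comm]; linarith)
    · obtain ⟨z, hz1, hz2⟩ := hlen p x R δ h hδ (by linarith)
      exact Metric.mem_cthickening_of_dist_le x z δ _ (Metric.mem_closedBall'.2 hz1.le)
        (by rw [dist_comm]; exact hz2.le)
  linarith [le_csSup hbdd hmem]

theorem exists_dist_lt_dist_lt (n : ℕ) {M : Type*} [MetricSpace M] [ChartedSpace (Model n) M]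
    [RiemannianBundle (fun x : M ↦ TangentSpace (𝓡 n) x)] [IsRiemannianManifold (𝓡 n) M]
    {x y : M} {r s : ℝ} (hr : 0 < r) (hs : 0 < s)
    (h : dist x y < r + s) : ∃ z, dist x z < r ∧ dist z y < s := by
  by_cases hxy : dist x y < r
  · exact ⟨y, hxy, by simpa using hs⟩
  push Not at hxy
  have h1 : Manifold.riemannianEDist (𝓡 n) x y < ENNReal.ofReal (r + s) := by
    rw [← IsRiemannianManifold.out (I := 𝓡 n), edist_dist]
    exact (ENNReal.ofReal_lt_ofReal_iff (by linarith)).2 h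
  obtain ⟨γ, h0, h1, hγ, hL⟩ := Manifold.exists_lt_of_riemannianEDist_lt h1
  set L := Manifold.pathELength (𝓡 n) γ 0 1 with hLdef
  have hLtop : L ≠ ⊤ := (hL.trans ENNReal.ofReal_lt_top).ne
  have hLr : L.toReal < r + s := (ENNReal.lt_ofReal_iff_toReal_lt hLtop).1 hL
  -- A point of a nearly minimal path at distance `r'` from `x` has used up at least `r'` of the
  -- length `L`, leaving at most `L - r' < s` to reach `y`.
  obtain ⟨r', hr'1, hr'2⟩ := exists_between (max_lt (show L.toReal - s < r by linarith) hr)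
  have hcont : ContinuousOn (fun t ↦ dist x (γ t)) (Set.Icc 0 1) :=
    (continuous_const.dist continuous_id).comp_continuousOn hγ.continuousOn
  obtain ⟨t, ht, hxt⟩ : ∃ t ∈ Set.Icc (0 : ℝ) 1, dist x (γ t) = r' := by
    refine intermediate_value_Icc zero_le_one hcont ⟨?_, ?_⟩
    · simp only [h0, dist_self]; exact (le_max_right _ _).trans hr'1.le
    · simp only [h1]; linarith
  refine ⟨γ t, hxt ▸ hr'2, ?_⟩
  have hsum := Manifold.pathELength_add (I := 𝓡 n) (γ := γ) ht.1 ht.2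
  have ha : edist x (γ t) ≤ Manifold.pathELength (𝓡 n) γ 0 t := by
    rw [IsRiemannianManifold.out (I := 𝓡 n)]
    exact Manifold.riemannianEDist_le_pathELength
      (hγ.mono (Set.Icc_subset_Icc_right ht.2)) h0 rfl ht.1
  have hb : edist (γ t) y ≤ Manifold.pathELength (𝓡 n) γ t 1 := by
    rw [IsRiemannianManifold.out (I := 𝓡 n)]
    exact Manifold.riemannianEDist_le_pathELength
      (hγ.mono (Set.Icc_subset_Icc_left ht.1)) rfl h1 ht.2
  have hab : edist x (γ t) + edist (γ t) y ≤ L := (add_le_add ha hb).trans hsum.le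
  have := ENNReal.toReal_mono hLtop hab
  rw [ENNReal.toReal_add (edist_ne_top _ _) (edist_ne_top _ _), ← dist_edist, ← dist_edist] at this
  have := (le_max_left _ _).trans_lt hr'1
  linarith

theorem properSpace (n : ℕ) (M : Type*) [MetricSpace M] [ChartedSpace (Model n) M]
    [RiemannianBundle (fun x : M ↦ TangentSpace (𝓡 n) x)] [IsRiemannianManifold (𝓡 n) M]
    [CompleteSpace M] : ProperSpace M := by
  have : LocallyCompactSpace M := ChartedSpace.locallyCompactSpace (Model n) M
  exact properSpace_of_length fun x y r s hr hs h ↦ exists_dist_lt_dist_lt n hr hs h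

end HopfRinow

/-! ### Locally Lipschitz functions on open sets of `ℝⁿ` and integration by parts. -/

section Euclidean

open Filter Topology

theorem LocallyLipschitzOn.exists_of_isOpen {E : Type*} [PseudoMetricSpace E] {F : E → ℝ}
    {U : Set E} (hU : IsOpen U) (hF : LocallyLipschitzOn U F) {y : E} (hy : y ∈ U) :
    ∃ K, ∃ t ∈ 𝓝 y, LipschitzOnWith K F t := by
  obtain ⟨K, t, ht, h⟩ := hF hy
  exact ⟨K, t, hU.nhdsWithin_eq hy ▸ ht, h⟩

theorem LocallyLipschitzOn.mul_real {E : Type*} [PseudoMetricSpace E] {F G : E → ℝ} {U : Set E}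
    (hU : IsOpen U) (hF : LocallyLipschitzOn U F) (hG : LocallyLipschitzOn U G) :
    LocallyLipschitzOn U (fun y ↦ F y * G y) := by
  intro y hy
  obtain ⟨K₁, t₁, ht₁, h₁⟩ := LocallyLipschitzOn.exists_of_isOpen hU hF hy
  obtain ⟨K₂, t₂, ht₂, h₂⟩ := LocallyLipschitzOn.exists_of_isOpen hU hG hy
  obtain ⟨K₃, t₃, ht₃, h₃⟩ :=
    (contDiff_mul (𝕜 := ℝ) (𝔸 := ℝ) (n := 1)).locallyLipschitz (F y, G y)
  have hpair : LipschitzOnWith (max K₁ K₂) (fun z ↦ (F z, G z)) (t₁ ∩ t₂) :=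
    (h₁.mono Set.inter_subset_left).prodMk (h₂.mono Set.inter_subset_right)
  have hc : ContinuousAt (fun z ↦ (F z, G z)) y :=
    hpair.continuousOn.continuousAt (inter_mem ht₁ ht₂)
  refine ⟨K₃ * max K₁ K₂, t₁ ∩ t₂ ∩ (fun z ↦ (F z, G z)) ⁻¹' t₃,
    mem_nhdsWithin_of_mem_nhds (inter_mem (inter_mem ht₁ ht₂) (hc ht₃)), ?_⟩
  exact h₃.comp (hpair.mono Set.inter_subset_left) (fun z hz ↦ hz.2)

theorem LocallyLipschitzOn.locallyLipschitz_of_eq_zero {E : Type*} [PseudoMetricSpace E]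
    {F : E → ℝ} {U T : Set E} (hU : IsOpen U) (hF : LocallyLipschitzOn U F) (hT : IsClosed T)
    (hTU : T ⊆ U) (h0 : ∀ y, y ∉ T → F y = 0) : LocallyLipschitz F := by
  intro y
  by_cases hy : y ∈ U
  · exact LocallyLipschitzOn.exists_of_isOpen hU hF hy
  · refine ⟨0, Tᶜ, hT.isOpen_compl.mem_nhds (fun h ↦ hy (hTU h)), fun a ha b hb ↦ ?_⟩
    simp [h0 a ha, h0 b hb]

theorem exists_lipschitzWith_of_eq_zero {E : Type*} [NormedAddCommGroup E] [ProperSpace E]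
    {F : E → ℝ} (hF : LocallyLipschitz F) {T : Set E} (hT : IsCompact T)
    (h0 : ∀ y, y ∉ T → F y = 0) : ∃ K, LipschitzWith K F := by
  obtain ⟨R, hR⟩ := hT.isBounded.subset_closedBall 0
  obtain ⟨K, hK⟩ := hF.locallyLipschitzOn.exists_lipschitzOnWith_of_compact
    (isCompact_closedBall (0 : E) (R + 1))
  obtain ⟨B, hB⟩ := (isCompact_closedBall (0 : E) (R + 1)).exists_bound_of_continuousOn
    hF.continuous.continuousOn
  have hB0 : ∀ y, ‖F y‖ ≤ max B 0 := by
    intro y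
    by_cases hy : y ∈ Metric.closedBall (0 : E) (R + 1)
    · exact (hB y hy).trans (le_max_left _ _)
    · rw [h0 y (fun h ↦ hy (Metric.closedBall_subset_closedBall (by linarith) (hR h)))]
      simp
  -- Nearby pairs use the Lipschitz constant on the ball of radius `R + 1`. A point outside that
  -- ball is at distance at least `1` from `x`, so there the sup bound of `F` serves as a Lipschitz
  -- constant.
  have hmain : ∀ x y, x ∈ Metric.closedBall (0 : E) R →
      dist (F x) (F y) ≤ (K + (max B 0).toNNReal : NNReal) * dist x y := by
    intro x y hx
    have hKd : 0 ≤ (K : ℝ) * dist x y := by positivity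
    have hBd : 0 ≤ max B 0 * dist x y := by positivity
    rw [NNReal.coe_add, Real.coe_toNNReal _ (le_max_right _ _), add_mul]
    by_cases hy : y ∈ Metric.closedBall (0 : E) (R + 1)
    · have := hK.dist_le_mul x (Metric.closedBall_subset_closedBall (by linarith) hx) y hy
      linarith
    · have hxy : 1 ≤ dist x y := by
        rw [mem_closedBall_zero_iff] at hx hy
        rw [dist_comm, dist_eq_norm]
        linarith [norm_sub_norm_le y x]
      have h1 : dist (F x) (F y) ≤ max B 0 := by
        rw [h0 y (fun h ↦ hy (Metric.closedBall_subset_closedBall (by linarith) (hR h))),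
          dist_zero_right]
        exact hB0 x
      have h2 : max B 0 * 1 ≤ max B 0 * dist x y := by gcongr
      linarith
  refine ⟨K + (max B 0).toNNReal, LipschitzWith.of_dist_le_mul fun x y ↦ ?_⟩
  by_cases hx : x ∈ Metric.closedBall (0 : E) R
  · exact hmain x y hx
  by_cases hy : y ∈ Metric.closedBall (0 : E) R
  · rw [dist_comm, dist_comm x]; exact hmain y x hy
  · rw [h0 x (fun h ↦ hx (hR h)), h0 y (fun h ↦ hy (hR h)), dist_self]
    positivity

theorem locallyLipschitzOn_of_contDiffOn {n : ℕ} {F : Model n → ℝ} {U : Set (Model n)}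
    (hU : IsOpen U) (hF : ContDiffOn ℝ 1 F U) : LocallyLipschitzOn U F := by
  intro y hy
  obtain ⟨K, t, ht, h⟩ := (hF.contDiffAt (hU.mem_nhds hy)).exists_lipschitzOnWith
  exact ⟨K, t, mem_nhdsWithin_of_mem_nhds ht, h⟩

theorem exists_smooth_cutoff {n : ℕ} {K U : Set (Model n)} (hK : IsCompact K) (hU : IsOpen U)
    (hKU : K ⊆ U) : ∃ χ : Model n → ℝ, ∃ T : Set (Model n), ContDiff ℝ ∞ χ ∧ IsCompact T ∧ T ⊆ U ∧
      (∀ y, y ∉ T → χ y = 0) ∧ ∀ y ∈ K, ∀ᶠ z in 𝓝 y, χ z = 1 := by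
  obtain ⟨T, hT, hKT, hTU⟩ := exists_compact_between hK hU hKU
  obtain ⟨f, hf1, hf0, -⟩ := exists_contMDiffMap_one_nhds_of_subset_interior (n := ⊤) (𝓡 n)
    hK.isClosed hKT
  exact ⟨f, T, f.contMDiff.contDiff, hT, hTU, hf0,
    fun y hy ↦ eventually_nhdsSet_iff_forall.1 hf1 y hy⟩

/-- Rademacher's theorem, localized: the exceptional set is locally null, hence null. -/
theorem ae_differentiableAt_of_locallyLipschitzOn {n : ℕ} {F : Model n → ℝ} {U : Set (Model n)}
    (hU : IsOpen U) (hF : LocallyLipschitzOn U F) :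
    ∀ᵐ y ∂(volume : Measure (Model n)).restrict U, DifferentiableAt ℝ F y := by
  rw [ae_restrict_iff' hU.measurableSet, ae_iff]
  refine measure_null_of_locally_null _ fun y hy ↦ ?_
  have hyU : y ∈ U := by by_contra h; exact hy fun h' ↦ absurd h' h
  obtain ⟨K, t, ht, h⟩ := LocallyLipschitzOn.exists_of_isOpen hU hF hyU
  obtain ⟨s, hst, hs, hys⟩ := mem_nhds_iff.1 ht
  refine ⟨s ∩ {a | ¬(a ∈ U → DifferentiableAt ℝ F a)},
    mem_nhdsWithin.2 ⟨s, hs, hys, subset_rfl⟩, ?_⟩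
  have h1 := (h.mono hst).ae_differentiableWithinAt_of_mem (μ := (volume : Measure (Model n)))
  refine measure_mono_null (fun a ha ↦ ?_) (ae_iff.1 h1)
  intro h2
  exact ha.2 fun _ ↦ (h2 ha.1).differentiableAt (hs.mem_nhds ha.1)

theorem measurable_partialDeriv {n : ℕ} (i : Fin n) (F : Model n → ℝ) :
    Measurable (partialDeriv i F) :=
  measurable_fderiv_apply_const ℝ F _

theorem partialDeriv_congr {n : ℕ} {i : Fin n} {F G : Model n → ℝ} {y : Model n}
    (h : F =ᶠ[𝓝 y] G) : partialDeriv i F y = partialDeriv i G y := by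
  rw [partialDeriv, partialDeriv, h.fderiv_eq]

theorem integral_partialDeriv_mul_of_lipschitz {n : ℕ} {F G : Model n → ℝ} {C D : NNReal}
    (hF : LipschitzWith C F) (hG : LipschitzWith D G) (hGc : HasCompactSupport G) (i : Fin n) :
    ∫ y, partialDeriv i F y * G y = -∫ y, F y * partialDeriv i G y := by
  have h := hF.integral_lineDeriv_mul_eq (μ := (volume : Measure (Model n))) hG hGc
    (EuclideanSpace.single i 1)
  have h1 : ∫ y, partialDeriv i F y * G y
      = ∫ y, lineDeriv ℝ F y (EuclideanSpace.single i 1) * G y := by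
    refine integral_congr_ae ?_
    filter_upwards [hF.ae_differentiableAt (μ := (volume : Measure (Model n)))] with y hy
    rw [hy.lineDeriv_eq_fderiv, partialDeriv]
  rw [h1, h, ← integral_neg]
  refine integral_congr_ae ?_
  filter_upwards [hG.ae_differentiableAt (μ := (volume : Measure (Model n)))] with y hy
  rw [hy.lineDeriv_eq_fderiv, partialDeriv, map_neg]
  ring

/-- Integration by parts on an open set, for locally Lipschitz functions one of which vanishes
off a compact subset. -/
theorem setIntegral_partialDeriv_mul {n : ℕ} {F G : Model n → ℝ} {U K : Set (Model n)}
    (hU : IsOpen U) (hF : LocallyLipschitzOn U F) (hG : LocallyLipschitzOn U G)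
    (hK : IsCompact K) (hKU : K ⊆ U) (h0 : ∀ y ∈ U, y ∉ K → G y = 0) (i : Fin n) :
    ∫ y in U, partialDeriv i F y * G y = -∫ y in U, F y * partialDeriv i G y := by
  -- Multiplying by `χ` makes both functions globally Lipschitz with compact support. As `χ = 1`
  -- near every point of `K` and `G` vanishes on `U` off `K`, neither integral changes.
  obtain ⟨χ, T, hχ, hT, hTU, hχ0, hχ1⟩ := exists_smooth_cutoff hK hU hKU
  have hχL : LocallyLipschitzOn U χ :=
    (hχ.of_le (by simp)).locallyLipschitz.locallyLipschitzOn
  have hlip : ∀ F : Model n → ℝ, LocallyLipschitzOn U F →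
      ∃ C, LipschitzWith C (fun y ↦ χ y * F y) := fun F hF ↦
    exists_lipschitzWith_of_eq_zero
      (LocallyLipschitzOn.locallyLipschitz_of_eq_zero hU
        (LocallyLipschitzOn.mul_real hU hχL hF) hT.isClosed hTU
        fun y hy ↦ by simp [hχ0 y hy]) hT fun y hy ↦ by simp [hχ0 y hy]
  obtain ⟨C, hC⟩ := hlip F hF
  obtain ⟨D, hD⟩ := hlip G hG
  have hGc : HasCompactSupport (fun y ↦ χ y * G y) :=
    HasCompactSupport.intro hT fun y hy ↦ by simp [hχ0 y hy]
  have hχU : ∀ y, y ∉ U → χ y = 0 := fun y hy ↦ hχ0 y fun h ↦ hy (hTU h)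
  have hGχ : ∀ y ∈ U, χ y * G y = G y := by
    intro y hy
    by_cases hyK : y ∈ K
    · rw [(hχ1 y hyK).self_of_nhds, one_mul]
    · rw [h0 y hy hyK, mul_zero]
  have key := integral_partialDeriv_mul_of_lipschitz hC hD hGc i
  have e1 : ∫ y in U, partialDeriv i F y * G y
      = ∫ y, partialDeriv i (fun y ↦ χ y * F y) y * (χ y * G y) := by
    rw [← setIntegral_eq_integral_of_forall_compl_eq_zero (s := U)
      (f := fun y ↦ partialDeriv i (fun y ↦ χ y * F y) y * (χ y * G y))
      fun y hy ↦ by simp [hχU y hy]]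
    refine setIntegral_congr_fun hU.measurableSet fun y hy ↦ ?_
    rw [hGχ y hy]
    by_cases hyK : y ∈ K
    · congr 1
      refine partialDeriv_congr ?_
      filter_upwards [hχ1 y hyK] with z hz
      rw [hz, one_mul]
    · rw [h0 y hy hyK, mul_zero, mul_zero]
  have e2 : ∫ y in U, F y * partialDeriv i G y
      = ∫ y, (χ y * F y) * partialDeriv i (fun y ↦ χ y * G y) y := by
    rw [← setIntegral_eq_integral_of_forall_compl_eq_zero (s := U)
      (f := fun y ↦ (χ y * F y) * partialDeriv i (fun y ↦ χ y * G y) y)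
      fun y hy ↦ by simp [hχU y hy]]
    refine setIntegral_congr_fun hU.measurableSet fun y hy ↦ ?_
    have hG' : partialDeriv i (fun y ↦ χ y * G y) y = partialDeriv i G y := by
      refine partialDeriv_congr ?_
      filter_upwards [hU.mem_nhds hy] with z hz using hGχ z hz
    rw [hG']
    by_cases hyK : y ∈ K
    · rw [(hχ1 y hyK).self_of_nhds, one_mul]
    · have : partialDeriv i G y = 0 := by
        have h1 : G =ᶠ[𝓝 y] fun _ ↦ 0 := by
          filter_upwards [(hU.inter hK.isClosed.isOpen_compl).mem_nhds ⟨hy, hyK⟩] with z hz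
            using h0 z hz.1 hz.2
        rw [partialDeriv_congr h1, partialDeriv]
        simp
      rw [this, mul_zero, mul_zero]
  rw [e1, e2, key]

end Euclidean

/-! ### Gradients of Lipschitz functions: pointwise bounds and weak gradients. -/

section Gradient

open Filter Topology

variable {n : ℕ} {M : Type*} [MetricSpace M] [ChartedSpace (Model n) M]
  [RiemannianBundle (fun x : M ↦ TangentSpace (𝓡 n) x)]

theorem grad_eq_zero_of_eventuallyEq {f : M → ℝ} {x : M} (h : f =ᶠ[𝓝 x] fun _ ↦ 0) :
    grad (n := n) f x = 0 := by
  refine ext_inner_right ℝ fun w ↦ ?_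
  rw [inner_grad, inner_zero_left, h.mfderiv_eq, mfderiv_const]
  rfl

theorem grad_eq_zero_of_not_mdifferentiableAt {f : M → ℝ} {x : M}
    (h : ¬MDifferentiableAt (𝓡 n) 𝓘(ℝ, ℝ) f x) : grad (n := n) f x = 0 := by
  refine ext_inner_right ℝ fun w ↦ ?_
  rw [inner_grad, inner_zero_left, mfderiv_zero_of_not_mdifferentiableAt h]
  rfl

variable [IsManifold (𝓡 n) ∞ M]

/-- The Riemannian distance is at most the length of the image of the segment from `a` to `b`, a
curve over unit time with speed at most `c`. -/
theorem dist_symm_le_of_norm_le [IsRiemannianManifold (𝓡 n) M] {e : OpenPartialHomeomorph M (Model n)}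
    (he : e ∈ IsManifold.maximalAtlas (𝓡 n) ∞ M) {a b : Model n} {c : ℝ} (hc : 0 ≤ c)
    (hseg : ∀ t ∈ Set.Icc (0 : ℝ) 1, AffineMap.lineMap a b t ∈ e.target ∧
      ‖(mfderiv (𝓡 n) (𝓡 n) e.symm (AffineMap.lineMap a b t) (b - a : Model n) :
        TangentSpace (𝓡 n) (e.symm (AffineMap.lineMap a b t)))‖ ≤ c) :
    dist (e.symm a) (e.symm b) ≤ c := by
  set γ : ℝ → M := fun t ↦ e.symm (AffineMap.lineMap a b t)
  have hline : ContDiff ℝ ∞ (fun t : ℝ ↦ (AffineMap.lineMap a b t : Model n)) := by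
    simp only [AffineMap.lineMap_apply_module]
    fun_prop
  have hγ : ContMDiffOn 𝓘(ℝ, ℝ) (𝓡 n) 1 γ (Set.Icc 0 1) := by
    refine ((contMDiffOn_symm_of_mem_maximalAtlas he).of_le (by simp)).comp
      (hline.contMDiff.contMDiffOn.of_le (by simp)) fun t ht ↦ (hseg t ht).1
  have h1 : edist (e.symm a) (e.symm b) ≤ ENNReal.ofReal c := by
    rw [IsRiemannianManifold.out (I := 𝓡 n)]
    refine (Manifold.riemannianEDist_le_pathELength hγ (by simp [γ]) (by simp [γ])
      zero_le_one).trans ?_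
    rw [Manifold.pathELength_eq_lintegral_mfderiv_Icc]
    calc _ ≤ ∫⁻ t in Set.Icc (0 : ℝ) 1, ENNReal.ofReal c := by
          refine setLIntegral_mono measurable_const fun t ht ↦ ?_
          have hd : (mfderiv 𝓘(ℝ, ℝ) (𝓡 n) γ t (1 : ℝ) : TangentSpace (𝓡 n) (γ t)) =
              mfderiv (𝓡 n) (𝓡 n) e.symm (AffineMap.lineMap a b t) (b - a : Model n) := by
            have hl : HasDerivAt (fun t : ℝ ↦ (AffineMap.lineMap a b t : Model n)) (b - a) t :=
              AffineMap.hasDerivAt_lineMap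
            have hcomp := mfderiv_comp (I := 𝓘(ℝ, ℝ)) (I' := 𝓡 n) (I'' := 𝓡 n) t (g := e.symm)
              (f := fun t : ℝ ↦ (AffineMap.lineMap a b t : Model n))
              ((mdifferentiable_of_mem_maximalAtlas he).mdifferentiableAt_symm (hseg t ht).1)
              hl.differentiableAt.mdifferentiableAt
            rw [mfderiv_eq_fderiv] at hcomp
            have h2 := congrArg (fun L ↦ (L (1 : ℝ) : Model n)) hcomp
            refine h2.trans ?_
            have h3 : fderiv ℝ (fun t : ℝ ↦ (AffineMap.lineMap a b t : Model n)) t 1 = b - a := by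
              rw [fderiv_apply_one_eq_deriv, hl.deriv]
            exact congrArg (fun v : Model n ↦ (mfderiv (𝓡 n) (𝓡 n) e.symm
              (AffineMap.lineMap a b t) v : Model n)) h3
          refine (congrArg (fun v : TangentSpace (𝓡 n) (γ t) ↦ ‖v‖ₑ) hd).le.trans ?_
          rw [← ofReal_norm]
          exact ENNReal.ofReal_le_ofReal (hseg t ht).2
      _ = ENNReal.ofReal c := by simp
  rw [edist_dist] at h1
  exact (ENNReal.ofReal_le_ofReal_iff hc).1 h1

variable [IsContMDiffRiemannianBundle (𝓡 n) ∞ (Model n) (fun x : M ↦ TangentSpace (𝓡 n) x)]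

theorem continuousOn_norm_mfderiv_symm {e : OpenPartialHomeomorph M (Model n)}
    (he : e ∈ IsManifold.maximalAtlas (𝓡 n) ∞ M) (v : Model n) :
    ContinuousOn (fun y ↦ ‖(mfderiv (𝓡 n) (𝓡 n) e.symm y v : TangentSpace (𝓡 n) (e.symm y))‖)
      e.target := by
  have h : ∀ y, ‖(mfderiv (𝓡 n) (𝓡 n) e.symm y v : TangentSpace (𝓡 n) (e.symm y))‖ =
      √(∑ i, v i * ∑ j, v j * metricMatrix e y i j) := by
    intro y
    rw [norm_eq_sqrt_real_inner, mfderiv_symm_apply_eq_sum]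
    congr 1
    simp only [sum_inner, inner_sum, inner_smul_left, inner_smul_right]
    simp [metricMatrix, real_inner_comm]
  simp only [h]
  refine Real.continuous_sqrt.comp_continuousOn (continuousOn_finsetSum _ fun i _ ↦
    continuousOn_const.mul (continuousOn_finsetSum _ fun j _ ↦
    continuousOn_const.mul (contDiffOn_metricMatrix he i j).continuousOn))

theorem exists_norm_mfderiv_symm_le {e : OpenPartialHomeomorph M (Model n)}
    (he : e ∈ IsManifold.maximalAtlas (𝓡 n) ∞ M) {y : Model n} (hy : y ∈ e.target) :
    ∃ C : NNReal, ∀ᶠ z in 𝓝 y, ∀ v : Model n,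
      ‖(mfderiv (𝓡 n) (𝓡 n) e.symm z v : TangentSpace (𝓡 n) (e.symm z))‖ ≤ C * ‖v‖ := by
  have hc : ContinuousAt (fun z ↦ ∑ i, ‖coordVec e i z‖) y :=
    (continuousOn_finsetSum _ fun i _ ↦
      continuousOn_norm_mfderiv_symm he _).continuousAt (e.open_target.mem_nhds hy)
  refine ⟨⟨∑ i, ‖coordVec e i y‖ + 1, by positivity⟩, ?_⟩
  filter_upwards [hc.eventually_lt_const (lt_add_one _)] with z hz v
  rw [mfderiv_symm_apply_eq_sum]
  calc ‖∑ i, v i • coordVec e i z‖ ≤ ∑ i, ‖v i • coordVec e i z‖ := norm_sum_le _ _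
    _ ≤ ∑ i, ‖v‖ * ‖coordVec e i z‖ := by
        refine Finset.sum_le_sum fun i _ ↦ ?_
        rw [norm_smul]
        gcongr
        exact PiLp.norm_apply_le v i
    _ = (∑ i, ‖coordVec e i z‖) * ‖v‖ := by rw [← Finset.mul_sum, mul_comm]
    _ ≤ _ := by
      gcongr
      exact hz.le

/-- Partial derivatives of arbitrary functions are measurable, with the default value `0` where
there is no derivative, so the coordinate formula needs no regularity of `f` and `h`. -/
theorem aestronglyMeasurable_inner_grad [SecondCountableTopology M] [MeasurableSpace M]
    [BorelSpace M] (f h : M → ℝ) :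
    AEStronglyMeasurable (fun x ↦ (inner ℝ (grad (n := n) f x) (grad h x) : ℝ))
      (riemannianVolume n M) := by
  refine aestronglyMeasurable_of_forall_chart fun e he ↦ ?_
  have h1 : AEStronglyMeasurable (fun y ↦ ∑ i, (∑ j, (metricMatrix e y)⁻¹ i j *
      partialDeriv j (f ∘ e.symm) y) * partialDeriv i (h ∘ e.symm) y)
      ((volume : Measure (Model n)).restrict e.target) := by
    refine Finset.aestronglyMeasurable_fun_sum _ fun i _ ↦ (Finset.aestronglyMeasurable_fun_sum _
      fun j _ ↦ ?_).mul (measurable_partialDeriv i _).aestronglyMeasurable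
    exact ((contDiffOn_metricMatrix_inv he i j).continuousOn.aestronglyMeasurable
      e.open_target.measurableSet).mul (measurable_partialDeriv j _).aestronglyMeasurable
  refine h1.congr ?_
  filter_upwards [ae_restrict_mem e.open_target.measurableSet] with y hy
  exact (inner_grad_grad he hy f h).symm

theorem aestronglyMeasurable_norm_grad [SecondCountableTopology M] [MeasurableSpace M]
    [BorelSpace M] (f : M → ℝ) :
    AEStronglyMeasurable (fun x ↦ ‖grad (n := n) f x‖) (riemannianVolume n M) := by
  simp only [norm_eq_sqrt_real_inner]
  exact Real.continuous_sqrt.comp_aestronglyMeasurable (aestronglyMeasurable_inner_grad f f)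

variable [IsRiemannianManifold (𝓡 n) M]

/-- The differential of `e.symm` is locally bounded and balls in `ℝⁿ` are convex, so `e.symm` is
Lipschitz near each point. -/
theorem locallyLipschitzOn_comp_symm {e : OpenPartialHomeomorph M (Model n)}
    (he : e ∈ IsManifold.maximalAtlas (𝓡 n) ∞ M) {f : M → ℝ} {K : NNReal}
    (hf : LipschitzWith K f) : LocallyLipschitzOn e.target (f ∘ e.symm) := by
  intro y hy
  obtain ⟨C, hC⟩ := exists_norm_mfderiv_symm_le he hy
  obtain ⟨ε, hε, hball⟩ := Metric.eventually_nhds_iff_ball.1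
    (hC.and (e.open_target.mem_nhds hy))
  refine ⟨K * C, Metric.ball y ε, mem_nhdsWithin_of_mem_nhds (Metric.ball_mem_nhds y hε),
    hf.comp_lipschitzOnWith (LipschitzOnWith.of_dist_le_mul fun a ha b hb ↦ ?_)⟩
  refine dist_symm_le_of_norm_le he (by positivity) fun t ht ↦ ?_
  have hmem : AffineMap.lineMap a b t ∈ Metric.ball y ε :=
    (convex_ball y ε).lineMap_mem ha hb ht
  refine ⟨(hball _ hmem).2, ((hball _ hmem).1 _).trans ?_⟩
  rw [dist_comm, dist_eq_norm]

/-- Difference quotients of `f` along a coordinate line are at most `K` times the speed of its image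
in `M`, so `|df(X)| ≤ K ‖X‖`; the choice `X = ∇f` gives the bound. -/
theorem norm_grad_symm_le {e : OpenPartialHomeomorph M (Model n)}
    (he : e ∈ IsManifold.maximalAtlas (𝓡 n) ∞ M) {y : Model n} (hy : y ∈ e.target)
    {f : M → ℝ} {K : NNReal} (hf : LipschitzWith K f) :
    ‖grad (n := n) f (e.symm y)‖ ≤ K := by
  by_cases hd : MDifferentiableAt (𝓡 n) 𝓘(ℝ, ℝ) f (e.symm y)
  swap
  · rw [grad_eq_zero_of_not_mdifferentiableAt hd, norm_zero]; exact K.2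
  have hd' := (mdifferentiableAt_symm_iff he hy).1 hd
  have key : ∀ v : Model n, |inner ℝ (grad (n := n) f (e.symm y))
      (mfderiv (𝓡 n) (𝓡 n) e.symm y v : TangentSpace (𝓡 n) (e.symm y))| ≤
      K * ‖(mfderiv (𝓡 n) (𝓡 n) e.symm y v : TangentSpace (𝓡 n) (e.symm y))‖ := by
    intro v
    set N := fun z ↦ ‖(mfderiv (𝓡 n) (𝓡 n) e.symm z v : TangentSpace (𝓡 n) (e.symm z))‖ with hN
    have heq : (inner ℝ (grad (n := n) f (e.symm y))
        (mfderiv (𝓡 n) (𝓡 n) e.symm y v : TangentSpace (𝓡 n) (e.symm y)) : ℝ) =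
        fderiv ℝ (f ∘ e.symm) y v := by
      rw [inner_grad]
      have h1 := mfderiv_comp y hd
        ((mdifferentiable_of_mem_maximalAtlas he).mdifferentiableAt_symm hy)
      rw [mfderiv_eq_fderiv] at h1
      rw [h1]
      rfl
    rw [heq]
    refine le_of_forall_pos_le_add fun ε hε ↦ ?_
    -- The denominator is `K + 1` because `K` may be zero.
    have hδ : ∃ δ > 0, (K : ℝ) * δ ≤ ε := ⟨ε / (K + 1), by positivity, by
      rw [mul_div_assoc', div_le_iff₀ (by positivity)]
      nlinarith [K.2]⟩
    obtain ⟨δ, hδ, hKδ⟩ := hδ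
    have hline : HasDerivAt (fun t : ℝ ↦ (f ∘ e.symm) (y + t • v)) (fderiv ℝ (f ∘ e.symm) y v) 0 := by
      have := hd'.hasFDerivAt.hasLineDerivAt v
      exact this
    have hcont := (continuousOn_norm_mfderiv_symm he v).continuousAt (e.open_target.mem_nhds hy)
    obtain ⟨r, hr, hball⟩ := Metric.eventually_nhds_iff_ball.1
      ((hcont.eventually_lt_const (lt_add_of_pos_right (N y) hδ)).and (e.open_target.mem_nhds hy))
    have hb : ‖fderiv ℝ (f ∘ e.symm) y v‖ ≤ K * (N y + δ) := by
      refine hline.le_of_lip' (by positivity) ?_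
      have hc2 : ContinuousAt (fun t : ℝ ↦ y + t • v) 0 := by fun_prop
      have hmem : ∀ᶠ t : ℝ in 𝓝 0, y + t • v ∈ Metric.ball y r :=
        hc2 (by simpa using Metric.ball_mem_nhds y hr)
      filter_upwards [hmem] with t ht
      have h3 : dist (e.symm y) (e.symm (y + t • v)) ≤ (N y + δ) * |t| := by
        refine dist_symm_le_of_norm_le he (by positivity) fun s hs ↦ ?_
        have hm : AffineMap.lineMap y (y + t • v) s ∈ Metric.ball y r :=
          (convex_ball y r).lineMap_mem (Metric.mem_ball_self hr) ht hs
        refine ⟨(hball _ hm).2, ?_⟩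
        have h4 : (mfderiv (𝓡 n) (𝓡 n) e.symm (AffineMap.lineMap y (y + t • v) s)
            (y + t • v - y : Model n) : TangentSpace (𝓡 n) _) =
            t • mfderiv (𝓡 n) (𝓡 n) e.symm (AffineMap.lineMap y (y + t • v) s) v := by
          rw [add_sub_cancel_left]
          exact map_smul (mfderiv (𝓡 n) (𝓡 n) e.symm (AffineMap.lineMap y (y + t • v) s)) t v
        rw [h4, norm_smul, Real.norm_eq_abs, mul_comm]
        gcongr
        exact (hball _ hm).1.le
      have h5 := hf.dist_le_mul (e.symm (y + t • v)) (e.symm y)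
      rw [dist_comm (e.symm _)] at h5
      simp only [Function.comp, zero_smul, add_zero, sub_zero]
      rw [← dist_eq_norm, Real.norm_eq_abs, mul_assoc]
      exact h5.trans (by gcongr)
    rw [← Real.norm_eq_abs]
    nlinarith
  obtain ⟨v, hv⟩ := (mdifferentiable_of_mem_maximalAtlas he).symm.mfderiv_surjective hy
    (grad f (e.symm y))
  have h1 := key v
  have hv' : (mfderiv (𝓡 n) (𝓡 n) e.symm y (v : Model n) : TangentSpace (𝓡 n) (e.symm y)) =
    grad f (e.symm y) := hv
  rw [hv', real_inner_self_eq_norm_sq, abs_of_nonneg (sq_nonneg _), sq] at h1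
  by_contra! hlt
  have hK := K.2
  have : 0 < ‖grad (n := n) f (e.symm y)‖ := lt_of_le_of_lt hK hlt
  exact absurd (le_of_mul_le_mul_right h1 this) hlt.not_ge

theorem norm_grad_le {f : M → ℝ} {K : NNReal} (hf : LipschitzWith K f) (x : M) :
    ‖grad (n := n) f x‖ ≤ K := by
  have h := norm_grad_symm_le (IsManifold.chart_mem_maximalAtlas x)
    ((chartAt (Model n) x).map_source (mem_chart_source _ x)) hf
  rwa [(chartAt (Model n) x).left_inv (mem_chart_source _ x)] at h

/-- Integration by parts in a chart against a test function; this makes the cutoffs admissible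
competitors in `lambdaConst`. -/
theorem isWeakGradient_grad {f : M → ℝ} {K : NNReal} (hf : LipschitzWith K f) :
    IsWeakGradient (n := n) f (grad f) := by
  intro e he i
  have hloc := locallyLipschitzOn_comp_symm he hf
  refine ⟨hloc.continuousOn.locallyIntegrableOn e.open_target.measurableSet, ?_, ?_⟩
  · have h1 : LocallyIntegrableOn (fun y ↦ K * ‖coordVec e i y‖) e.target :=
      (continuousOn_const.mul (continuousOn_norm_mfderiv_symm he _)).locallyIntegrableOn
        e.open_target.measurableSet
    have hm : AEStronglyMeasurable
        (fun y ↦ (inner ℝ (grad f (e.symm y)) (coordVec e i y) : ℝ))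
        ((volume : Measure (Model n)).restrict e.target) := by
      refine (measurable_partialDeriv i (f ∘ e.symm)).aestronglyMeasurable.congr ?_
      filter_upwards [ae_restrict_mem e.open_target.measurableSet] with y hy
      exact (inner_grad_coordVec he hy f i).symm
    intro y hy
    obtain ⟨t, ht, hint⟩ := h1 y hy
    refine ⟨t ∩ e.target, inter_mem ht self_mem_nhdsWithin, Integrable.mono
      (hint.mono_set Set.inter_subset_left)
      (hm.mono_measure (Measure.restrict_mono Set.inter_subset_right le_rfl)) (.of_forall ?_)⟩
    intro z
    rw [Real.norm_eq_abs, norm_mul, norm_norm]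
    refine (abs_real_inner_le_norm _ _).trans ?_
    gcongr
    exact (norm_grad_le hf _).trans (le_abs_self _)
  · intro ψ hψ hψc hψU
    have h1 := setIntegral_partialDeriv_mul e.open_target hloc
      (hψ.of_le (by simp)).locallyLipschitz.locallyLipschitzOn hψc hψU
      (fun y _ hy ↦ image_eq_zero_of_notMem_tsupport hy) i
    have h2 : ∫ y in e.target, inner ℝ (grad f (e.symm y)) (coordVec e i y) * ψ y =
        ∫ y in e.target, partialDeriv i (f ∘ e.symm) y * ψ y := by
      refine setIntegral_congr_fun e.open_target.measurableSet fun y hy ↦ ?_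
      rw [inner_grad_coordVec he hy]
    rw [h2, h1, neg_neg]
    rfl

end Gradient

/-! ### Green's formula, first in a chart and then globally. -/

section Green

open Filter Topology

theorem exists_abs_partialDeriv_le {n : ℕ} {G : Model n → ℝ} {U K : Set (Model n)}
    (hU : IsOpen U) (hG : LocallyLipschitzOn U G)
    (hK : IsCompact K) (hKU : K ⊆ U) (h0 : ∀ y ∈ U, y ∉ K → G y = 0) :
    ∃ D : ℝ, ∀ y ∈ U, ∀ i, |partialDeriv i G y| ≤ D := by
  obtain ⟨χ, T, hχ, hT, hTU, hχ0, hχ1⟩ := exists_smooth_cutoff hK hU hKU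
  have hχL : LocallyLipschitzOn U χ :=
    (hχ.of_le (by simp)).locallyLipschitz.locallyLipschitzOn
  obtain ⟨D, hD⟩ := exists_lipschitzWith_of_eq_zero
      (LocallyLipschitzOn.locallyLipschitz_of_eq_zero hU
        (LocallyLipschitzOn.mul_real hU hχL hG) hT.isClosed hTU
        fun y hy ↦ by simp [hχ0 y hy]) hT fun y hy ↦ by simp [hχ0 y hy]
  refine ⟨D, fun y hy i ↦ ?_⟩
  have hG' : partialDeriv i G y = partialDeriv i (fun y ↦ χ y * G y) y := by
    refine partialDeriv_congr ?_
    filter_upwards [hU.mem_nhds hy] with z hz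
    by_cases hzK : z ∈ K
    · rw [(hχ1 z hzK).self_of_nhds, one_mul]
    · rw [h0 z hz hzK, mul_zero]
  rw [hG', partialDeriv, ← Real.norm_eq_abs]
  refine (ContinuousLinearMap.le_opNorm _ _).trans ?_
  simpa using norm_fderiv_le_of_lipschitz ℝ hD (x₀ := y)

theorem integrableOn_mul_partialDeriv {n : ℕ} {F G : Model n → ℝ} {U K : Set (Model n)}
    (hU : IsOpen U) (hF : ContinuousOn F U) (hG : LocallyLipschitzOn U G)
    (hK : IsCompact K) (hKU : K ⊆ U) (h0 : ∀ y ∈ U, y ∉ K → G y = 0) (i : Fin n) :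
    IntegrableOn (fun y ↦ F y * partialDeriv i G y) U := by
  obtain ⟨D, hD⟩ := exists_abs_partialDeriv_le hU hG hK hKU h0
  obtain ⟨B, hB⟩ := hK.exists_bound_of_continuousOn (hF.mono hKU)
  have hm : AEStronglyMeasurable (fun y ↦ F y * partialDeriv i G y)
      ((volume : Measure (Model n)).restrict K) :=
    ((hF.mono hKU).aestronglyMeasurable hK.measurableSet).mul
      (measurable_partialDeriv i G).aestronglyMeasurable
  have h1 : IntegrableOn (fun y ↦ F y * partialDeriv i G y) K := by
    refine IntegrableOn.of_bound hK.measure_lt_top hm (B * D) ?_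
    filter_upwards [ae_restrict_mem hK.measurableSet] with y hy
    rw [norm_mul]
    exact mul_le_mul (hB y hy) (hD y (hKU hy) i) (norm_nonneg _) ((norm_nonneg _).trans (hB y hy))
  refine h1.of_forall_sdiff_eq_zero hU.measurableSet fun y hy ↦ ?_
  have h2 : G =ᶠ[𝓝 y] fun _ ↦ 0 := by
    filter_upwards [(hU.inter hK.isClosed.isOpen_compl).mem_nhds hy] with z hz
      using h0 z hz.1 hz.2
  rw [partialDeriv_congr h2, partialDeriv]
  simp

theorem integrableOn_mul_of_eq_zero {n : ℕ} {F G : Model n → ℝ} {U K : Set (Model n)}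
    (hU : IsOpen U) (hF : ContinuousOn F U) (hG : ContinuousOn G U)
    (hK : IsCompact K) (hKU : K ⊆ U) (h0 : ∀ y ∈ U, y ∉ K → G y = 0) :
    IntegrableOn (fun y ↦ F y * G y) U :=
  (((hF.mul hG).mono hKU).integrableOn_compact hK).of_forall_sdiff_eq_zero hU.measurableSet
    fun y hy ↦ by rw [Pi.mul_apply, h0 y hy.1 hy.2, mul_zero]

theorem contDiffOn_partialDeriv {n : ℕ} {F : Model n → ℝ} {U : Set (Model n)}
    (hU : IsOpen U) (hF : ContDiffOn ℝ ∞ F U) (i : Fin n) :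
    ContDiffOn ℝ ∞ (partialDeriv i F) U :=
  (hF.fderiv_of_isOpen hU (m := ∞) (by simp)).clm_apply contDiffOn_const

variable {n : ℕ} {M : Type*} [MetricSpace M] [ChartedSpace (Model n) M]

theorem contDiffOn_comp_symm [IsManifold (𝓡 n) ∞ M] {e : OpenPartialHomeomorph M (Model n)}
    (he : e ∈ IsManifold.maximalAtlas (𝓡 n) ∞ M) {u : M → ℝ}
    (hu : ContMDiff (𝓡 n) 𝓘(ℝ, ℝ) ∞ u) : ContDiffOn ℝ ∞ (u ∘ e.symm) e.target :=
  contMDiffOn_iff_contDiffOn.1 (hu.comp_contMDiffOn (contMDiffOn_symm_of_mem_maximalAtlas he))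

variable [RiemannianBundle (fun x : M ↦ TangentSpace (𝓡 n) x)]

/-- The `i`-th component `√(det g) ∑_j g^{ij} ∂_j u` of the gradient density in a chart. -/
def flux (e : OpenPartialHomeomorph M (Model n)) (u : M → ℝ) (i : Fin n) (z : Model n) : ℝ :=
  volDensity e z * ∑ j, (metricMatrix e z)⁻¹ i j * partialDeriv j (u ∘ e.symm) z

variable [IsManifold (𝓡 n) ∞ M]
  [IsContMDiffRiemannianBundle (𝓡 n) ∞ (Model n) (fun x : M ↦ TangentSpace (𝓡 n) x)]

theorem contDiffOn_flux {e : OpenPartialHomeomorph M (Model n)}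
    (he : e ∈ IsManifold.maximalAtlas (𝓡 n) ∞ M) {u : M → ℝ}
    (hu : ContMDiff (𝓡 n) 𝓘(ℝ, ℝ) ∞ u) (i : Fin n) :
    ContDiffOn ℝ ∞ (flux e u i) e.target :=
  (contDiffOn_volDensity he).mul (ContDiffOn.sum fun j _ ↦
    (contDiffOn_metricMatrix_inv he i j).mul
      (contDiffOn_partialDeriv e.open_target (contDiffOn_comp_symm he hu) j))

/-- Supplies the continuity of `V`, hence measurability of `V h`: the coordinate expression is built
from smooth functions and a nonvanishing density. -/
theorem continuous_of_isLaplacian {u f : M → ℝ} (hu : ContMDiff (𝓡 n) 𝓘(ℝ, ℝ) ∞ u)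
    (hf : IsLaplacian (n := n) u f) : Continuous f := by
  refine continuous_iff_continuousAt.2 fun x ↦ ?_
  set e := chartAt (Model n) x
  have he : e ∈ IsManifold.maximalAtlas (𝓡 n) ∞ M := IsManifold.chart_mem_maximalAtlas x
  have hx : x ∈ e.source := mem_chart_source _ x
  have hc : ContinuousOn (chartLaplacian e u) e.target :=
    ((contDiffOn_volDensity he).continuousOn.inv₀ fun y hy ↦ (volDensity_pos he hy).ne').mul
      (continuousOn_finsetSum _ fun i _ ↦
        (contDiffOn_partialDeriv e.open_target (contDiffOn_flux he hu i) i).continuousOn)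
  have h1 : ContinuousOn f e.source :=
    (hc.comp e.continuousOn e.mapsTo).congr fun z hz ↦ hf e he z hz
  exact h1.continuousAt (e.open_source.mem_nhds hx)

theorem integrableOn_source_iff [MeasurableSpace M] [BorelSpace M]
    {e : OpenPartialHomeomorph M (Model n)}
    (he : e ∈ IsManifold.maximalAtlas (𝓡 n) ∞ M) {f : M → ℝ}
    (hf : AEStronglyMeasurable f (riemannianVolume n M)) :
    IntegrableOn f e.source (riemannianVolume n M) ↔
      IntegrableOn (fun y ↦ volDensity e y * f (e.symm y)) e.target := by
  have hf' := hf.restrict (s := e.source)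
  rw [IntegrableOn, riemannianVolume_restrict_source he] at *
  rw [chartVolume, integrable_map_measure hf' (aemeasurable_symm e),
    integrable_withDensity_iff_integrable_smul₀']
  · refine integrable_congr ?_
    filter_upwards [ae_restrict_mem e.open_target.measurableSet] with y hy
    simp [ENNReal.toReal_ofReal (volDensity_pos he hy).le]
  · exact ((contDiffOn_volDensity he).continuousOn.aemeasurable
      e.open_target.measurableSet).ennreal_ofReal
  · simp

/-- Green's formula for a function supported in a chart domain. -/
theorem green_formula_of_subset_source [SecondCountableTopology M] [MeasurableSpace M]
    [BorelSpace M] {e : OpenPartialHomeomorph M (Model n)}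
    (he : e ∈ IsManifold.maximalAtlas (𝓡 n) ∞ M) {V u h : M → ℝ}
    (hu : ContMDiff (𝓡 n) 𝓘(ℝ, ℝ) ∞ u) (hV : IsLaplacian (n := n) u (fun x ↦ -V x))
    (hcont : Continuous h) (hh : LocallyLipschitzOn e.target (h ∘ e.symm)) {K : Set M}
    (hK : IsCompact K) (hKe : K ⊆ e.source) (h0 : ∀ x, x ∉ K → h x = 0) :
    Integrable (fun x ↦ V x * h x) (riemannianVolume n M) ∧
    Integrable (fun x ↦ (inner ℝ (grad (n := n) u x) (grad h x) : ℝ)) (riemannianVolume n M) ∧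
    ∫ x, V x * h x ∂riemannianVolume n M =
      ∫ x, (inner ℝ (grad (n := n) u x) (grad h x) : ℝ) ∂riemannianVolume n M := by
  have hVc : Continuous V := 
    (continuous_of_isLaplacian hu hV).neg.congr fun x ↦ neg_neg _
  have hm1 : AEStronglyMeasurable (fun x ↦ V x * h x) (riemannianVolume n M) :=
    (hVc.mul hcont).aestronglyMeasurable
  have hm2 := aestronglyMeasurable_inner_grad (n := n) u h
  have hz1 : ∀ x, x ∉ e.source → V x * h x = 0 := fun x hx ↦ by
    rw [h0 x fun hxK ↦ hx (hKe hxK), mul_zero]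
  have hz2 : ∀ x, x ∉ e.source → (inner ℝ (grad (n := n) u x) (grad h x) : ℝ) = 0 := fun x hx ↦ by
    have h1 : h =ᶠ[𝓝 x] fun _ ↦ 0 := by
      filter_upwards [hK.isClosed.isOpen_compl.mem_nhds fun hxK ↦ hx (hKe hxK)] with z hz
        using h0 z hz
    rw [grad_eq_zero_of_eventuallyEq h1, inner_zero_right]
  set L := e '' K with hL
  have hLc : IsCompact L := hK.image_of_continuousOn (e.continuousOn.mono hKe)
  have hLt : L ⊆ e.target := by
    rintro _ ⟨x, hx, rfl⟩
    exact e.map_source (hKe hx)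
  have hL0 : ∀ y ∈ e.target, y ∉ L → (h ∘ e.symm) y = 0 := fun y hy hyL ↦
    h0 _ fun hyK ↦ hyL ⟨_, hyK, e.right_inv hy⟩
  have hF := fun i ↦ contDiffOn_flux he hu i
  -- The volume density cancels the factor `(det g)^(-1/2)` of the Laplacian, leaving a Euclidean
  -- divergence of the flux; in `hE2` it is absorbed into the flux.
  have hE1 : Set.EqOn (fun y ↦ volDensity e y * (V (e.symm y) * h (e.symm y)))
      (fun y ↦ ∑ i, -(partialDeriv i (flux e u i) y * (h ∘ e.symm) y)) e.target := by
    intro y hy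
    have h1 := hV e he (e.symm y) (e.map_target hy)
    rw [e.right_inv hy, chartLaplacian] at h1
    have h2 : V (e.symm y) = -((volDensity e y)⁻¹ * ∑ i, partialDeriv i (flux e u i) y) :=
      neg_eq_iff_eq_neg.1 h1
    have h3 := (volDensity_pos he hy).ne'
    simp only [Finset.sum_neg_distrib, ← Finset.sum_mul]
    rw [h2]
    simp only [Function.comp]
    field_simp
  have hE2 : Set.EqOn (fun y ↦ volDensity e y *
      (inner ℝ (grad (n := n) u (e.symm y)) (grad h (e.symm y)) : ℝ))
      (fun y ↦ ∑ i, flux e u i y * partialDeriv i (h ∘ e.symm) y) e.target := by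
    intro y hy
    simp only
    rw [inner_grad_grad he hy, Finset.mul_sum]
    refine Finset.sum_congr rfl fun i _ ↦ ?_
    rw [flux]
    ring
  have hI1 : ∀ i, IntegrableOn (fun y ↦ -(partialDeriv i (flux e u i) y * (h ∘ e.symm) y))
      e.target := fun i ↦ (integrableOn_mul_of_eq_zero e.open_target
        (contDiffOn_partialDeriv e.open_target (hF i) i).continuousOn hh.continuousOn hLc hLt
        hL0).neg
  have hI2 : ∀ i, IntegrableOn (fun y ↦ flux e u i y * partialDeriv i (h ∘ e.symm) y) e.target :=
    fun i ↦ integrableOn_mul_partialDeriv e.open_target (hF i).continuousOn hh hLc hLt hL0 i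
  refine ⟨?_, ?_, ?_⟩
  · rw [← integrableOn_iff_integrable_of_support_subset (s := e.source)
      fun x hx ↦ by_contra fun hxe ↦ hx (hz1 x hxe), integrableOn_source_iff he hm1]
    exact (integrableOn_congr_fun hE1 e.open_target.measurableSet).2
      (integrable_finsetSum _ fun i _ ↦ hI1 i)
  · rw [← integrableOn_iff_integrable_of_support_subset (s := e.source)
      fun x hx ↦ by_contra fun hxe ↦ hx (hz2 x hxe), integrableOn_source_iff he hm2]
    exact (integrableOn_congr_fun hE2 e.open_target.measurableSet).2
      (integrable_finsetSum _ fun i _ ↦ hI2 i)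
  · rw [← setIntegral_eq_integral_of_forall_compl_eq_zero hz1,
      ← setIntegral_eq_integral_of_forall_compl_eq_zero hz2, setIntegral_source_eq he hm1,
      setIntegral_source_eq he hm2, setIntegral_congr_fun e.open_target.measurableSet hE1,
      setIntegral_congr_fun e.open_target.measurableSet hE2,
      integral_finsetSum _ fun i _ ↦ hI1 i, integral_finsetSum _ fun i _ ↦ hI2 i]
    refine Finset.sum_congr rfl fun i _ ↦ ?_
    rw [integral_neg, setIntegral_partialDeriv_mul e.open_target
      (locallyLipschitzOn_of_contDiffOn e.open_target ((hF i).of_le (by simp))) hh hLc hLt hL0 i,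
      neg_neg]

/-- Green's formula for Lipschitz functions with compact support. -/
theorem green_formula [IsRiemannianManifold (𝓡 n) M] [SecondCountableTopology M]
    [MeasurableSpace M] [BorelSpace M] {V u h : M → ℝ}
    (hu : ContMDiff (𝓡 n) 𝓘(ℝ, ℝ) ∞ u) (hV : IsLaplacian (n := n) u (fun x ↦ -V x))
    {C : NNReal} (hh : LipschitzWith C h) {K : Set M}
    (hK : IsCompact K) (h0 : ∀ x, x ∉ K → h x = 0) :
    Integrable (fun x ↦ V x * h x) (riemannianVolume n M) ∧
    ∫ x, V x * h x ∂riemannianVolume n M =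
      ∫ x, (inner ℝ (grad (n := n) u x) (grad h x) : ℝ) ∂riemannianVolume n M := by
  have : LocallyCompactSpace M := ChartedSpace.locallyCompactSpace (Model n) M
  obtain ⟨ρ, hρ⟩ := SmoothPartitionOfUnity.exists_isSubordinate (𝓡 n) (isClosed_univ (X := M))
    (fun x : M ↦ (chartAt (Model n) x).source) (fun x ↦ (chartAt (Model n) x).open_source)
    (fun x _ ↦ Set.mem_iUnion.2 ⟨x, mem_chart_source _ x⟩)
  have hfin := ρ.locallyFinite.finite_nonempty_inter_compact hK
  -- Only finitely many partition functions are nonzero somewhere on the compact `K`, and these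
  -- already sum to `1` there.
  set t := hfin.toFinset
  have hsum : ∀ x, h x = ∑ i ∈ t, ρ i x * h x := by
    intro x
    by_cases hx : x ∈ K
    · have h1 : ∑ i ∈ t, ρ i x = 1 := by
        rw [← ρ.sum_eq_one (Set.mem_univ x)]
        refine (finsum_eq_sum_of_support_subset _ fun i hi ↦ ?_).symm
        simpa [t] using ⟨x, hi, hx⟩
      rw [← Finset.sum_mul, h1, one_mul]
    · simp [h0 x hx]
  have hloc : ∀ i, Integrable (fun x ↦ V x * (ρ i x * h x)) (riemannianVolume n M) ∧
      Integrable (fun x ↦ (inner ℝ (grad (n := n) u x) (grad (fun x ↦ ρ i x * h x) x) : ℝ))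
        (riemannianVolume n M) ∧
      ∫ x, V x * (ρ i x * h x) ∂riemannianVolume n M =
        ∫ x, (inner ℝ (grad (n := n) u x) (grad (fun x ↦ ρ i x * h x) x) : ℝ)
          ∂riemannianVolume n M := by
    intro i
    have he : chartAt (Model n) i ∈ IsManifold.maximalAtlas (𝓡 n) ∞ M :=
      IsManifold.chart_mem_maximalAtlas i
    refine green_formula_of_subset_source he hu hV
      ((ρ i).contMDiff.continuous.mul hh.continuous) ?_
      (hK.inter_right (isClosed_tsupport (ρ i))) (Set.inter_subset_right.trans (hρ i)) ?_
    · exact LocallyLipschitzOn.mul_real (chartAt (Model n) i).open_target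
        (locallyLipschitzOn_of_contDiffOn (chartAt (Model n) i).open_target
          ((contDiffOn_comp_symm he (ρ i).contMDiff).of_le (by simp)))
        (locallyLipschitzOn_comp_symm he hh)
    · intro x hx
      by_cases hxK : x ∈ K
      · rw [image_eq_zero_of_notMem_tsupport fun hxt ↦ hx ⟨hxK, hxt⟩, zero_mul]
      · rw [h0 x hxK, mul_zero]
  -- Additivity of the gradient needs each summand differentiable, which Rademacher's theorem for
  -- `h` gives almost everywhere.
  have hae : ∀ᵐ x ∂riemannianVolume n M, (inner ℝ (grad (n := n) u x) (grad h x) : ℝ) =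
      ∑ i ∈ t, (inner ℝ (grad (n := n) u x) (grad (fun x ↦ ρ i x * h x) x) : ℝ) := by
    refine ae_of_forall_chart fun e he ↦ ?_
    filter_upwards [ae_differentiableAt_of_locallyLipschitzOn e.open_target
      (locallyLipschitzOn_comp_symm he hh), ae_restrict_mem e.open_target.measurableSet] with y hd hy
    have hρd : ∀ i, DifferentiableAt ℝ ((ρ i) ∘ e.symm) y := fun i ↦
      ((contDiffOn_comp_symm he (ρ i).contMDiff).contDiffAt
        (e.open_target.mem_nhds hy)).differentiableAt (by simp)
    have hp : ∀ k, partialDeriv k (h ∘ e.symm) y =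
        ∑ i ∈ t, partialDeriv k ((fun x ↦ ρ i x * h x) ∘ e.symm) y := by
      intro k
      have h1 : h ∘ e.symm = fun y ↦ ∑ i ∈ t, ((fun x ↦ ρ i x * h x) ∘ e.symm) y := by
        funext y
        exact hsum _
      have h2 : ∀ i ∈ t, DifferentiableAt ℝ ((fun x ↦ ρ i x * h x) ∘ e.symm) y :=
        fun i _ ↦ (hρd i).mul hd
      conv_lhs => rw [partialDeriv, h1]
      rw [fderiv_fun_sum h2, sum_apply]
      rfl
    simp only [inner_grad_grad he hy, hp, Finset.mul_sum]
    rw [Finset.sum_comm]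
  have hV' : (fun x ↦ V x * h x) = fun x ↦ ∑ i ∈ t, V x * (ρ i x * h x) := by
    funext x
    rw [← Finset.mul_sum, ← hsum]
  rw [hV', integral_congr_ae hae, integral_finsetSum _ fun i _ ↦ (hloc i).1,
    integral_finsetSum _ fun i _ ↦ (hloc i).2.1]
  exact ⟨integrable_finsetSum _ fun i _ ↦ (hloc i).1,
    Finset.sum_congr rfl fun i _ ↦ (hloc i).2.2⟩

end Green

/-! ### Doubling scales, normalized cutoffs and the bounds for `λ_V`. -/

section TestFunctions

open Filter Topology

/-- A function of polynomial growth satisfies a doubling inequality at arbitrarily large scales. -/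
theorem exists_doubling_of_polynomial_growth {v : ℝ → ℝ} {C k : ℝ}
    (hpos : ∀ R, 1 ≤ R → 0 < v R) (hv : ∀ R, 1 ≤ R → v R ≤ C * R ^ k) :
    ∃ D > 0, ∀ R₀, ∃ R, R₀ ≤ R ∧ 1 ≤ R ∧ v (4 * R) ≤ D * v R := by
  -- The rate `4^k` per step is what growth `R^k` permits; the extra factor `4` makes failure at all
  -- scales beyond `R₁` impossible: it would force `4^m ≤ C R₁^k / v R₁` for every `m`.
  refine ⟨4 * 4 ^ k, by positivity, fun R₀ ↦ ?_⟩
  by_contra! hcon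
  set R₁ := max R₀ 1
  have hR₁ : 1 ≤ R₁ := le_max_right _ _
  have hge : ∀ m : ℕ, 1 ≤ (4 : ℝ) ^ m := fun m ↦ one_le_pow₀ (by norm_num)
  have hind : ∀ m : ℕ, (4 * (4 : ℝ) ^ k) ^ m * v R₁ ≤ v (4 ^ m * R₁) := by
    intro m
    induction m with
    | zero => simp
    | succ m ih =>
      have h1 : R₁ ≤ 4 ^ m * R₁ := le_mul_of_one_le_left (by linarith) (hge m)
      have h2 := hcon (4 ^ m * R₁) ((le_max_left _ _).trans h1) (hR₁.trans h1)
      have h3 : (4 : ℝ) * (4 ^ m * R₁) = 4 ^ (m + 1) * R₁ := by ring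
      rw [h3] at h2
      calc (4 * (4 : ℝ) ^ k) ^ (m + 1) * v R₁ = 4 * 4 ^ k * ((4 * (4 : ℝ) ^ k) ^ m * v R₁) := by ring
        _ ≤ 4 * 4 ^ k * v (4 ^ m * R₁) := by gcongr
        _ ≤ _ := h2.le
  obtain ⟨m, hm⟩ := pow_unbounded_of_one_lt (C * R₁ ^ k / v R₁) (show (1 : ℝ) < 4 by norm_num)
  have h1 : R₁ ≤ 4 ^ m * R₁ := le_mul_of_one_le_left (by linarith) (hge m)
  have h2 := (hind m).trans (hv _ (hR₁.trans h1))
  have hpow : ((4 : ℝ) ^ m) ^ k = (4 ^ k) ^ m := by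
    rw [← Real.rpow_natCast, ← Real.rpow_natCast, ← Real.rpow_mul (by norm_num),
      ← Real.rpow_mul (by norm_num), mul_comm]
  rw [Real.mul_rpow (by positivity) (by linarith), hpow, mul_pow] at h2
  rw [div_lt_iff₀ (hpos _ hR₁)] at hm
  have h4 : (0 : ℝ) < (4 ^ k) ^ m := by positivity
  nlinarith

/-- The cutoff function equal to `1` on the ball of radius `R` around `p` and to `0` outside the
ball of radius `2R`. -/
def ballCutoff {M : Type*} [MetricSpace M] (p : M) (R : ℝ) (x : M) : ℝ :=
  max 0 (min 1 (2 - dist x p / R))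

section Cutoff

variable {M : Type*} [MetricSpace M] {p : M} {R : ℝ}

theorem ballCutoff_nonneg (x : M) : 0 ≤ ballCutoff p R x := le_max_left _ _

theorem ballCutoff_le_one (x : M) : ballCutoff p R x ≤ 1 :=
  max_le zero_le_one (min_le_left _ _)

theorem ballCutoff_eq_one (hR : 0 < R) {x : M} (hx : x ∈ Metric.ball p R) :
    ballCutoff p R x = 1 := by
  have : dist x p / R < 1 := (div_lt_one hR).2 hx
  rw [ballCutoff, min_eq_left (by linarith), max_eq_right zero_le_one]

theorem ballCutoff_eq_zero (hR : 0 < R) {x : M} (hx : x ∉ Metric.closedBall p (2 * R)) :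
    ballCutoff p R x = 0 := by
  have : 2 < dist x p / R := by
    rw [lt_div_iff₀ hR]
    simpa using hx
  exact max_eq_left ((min_le_right _ _).trans (by linarith))

theorem abs_ballCutoff_sub_le (hR : 0 < R) (x y : M) :
    |ballCutoff p R x - ballCutoff p R y| ≤ dist x y / R := by
  refine (abs_max_sub_max_le_max _ _ _ _).trans (max_le (by simpa using by positivity) ?_)
  refine (abs_min_sub_min_le_max _ _ _ _).trans (max_le (by simpa using by positivity) ?_)
  have h : 2 - dist x p / R - (2 - dist y p / R) = (dist y p - dist x p) / R := by ring
  rw [h, abs_div, abs_of_pos hR]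
  gcongr
  rw [dist_comm x y]
  exact abs_dist_sub_le _ _ _

end Cutoff

theorem integrable_of_bound_of_eq_zero {X : Type*} [MeasurableSpace X] {μ : Measure X}
    {g : X → ℝ} {B : Set X} {b : ℝ} (hfin : μ B < ⊤)
    (hg : AEStronglyMeasurable g μ) (hb : ∀ x, |g x| ≤ b) (h0 : ∀ x, x ∉ B → g x = 0) :
    Integrable g μ ∧ ∫ x, g x ∂μ ≤ b * μ.real B := by
  have h1 : IntegrableOn g B μ := IntegrableOn.of_bound hfin hg.restrict b (.of_forall hb)
  refine ⟨(integrableOn_iff_integrable_of_support_subset fun x hx ↦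
    by_contra fun hxB ↦ hx (h0 x hxB)).1 h1, ?_⟩
  rw [← setIntegral_eq_integral_of_forall_compl_eq_zero h0]
  exact (le_abs_self _).trans
    (norm_setIntegral_le_of_norm_le_const (f := g) (C := b) hfin fun x _ ↦ hb x)

/-- The normalized cutoff function of a ball. -/
theorem exists_normalized_cutoff {M : Type*} [MetricSpace M] [MeasurableSpace M] [BorelSpace M]
    {μ : Measure M} {p : M} {R D : ℝ} (hR : 1 ≤ R)
    (hpos : 0 < μ (Metric.ball p R)) (hfin : μ (Metric.ball p (4 * R)) < ⊤)
    (hD : μ.real (Metric.ball p (4 * R)) ≤ D * μ.real (Metric.ball p R)) :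
    ∃ (w : M → ℝ) (c : ℝ), 0 ≤ c ∧ (∀ x, x ∉ Metric.closedBall p (2 * R) → w x = 0) ∧
      (∀ x, 0 ≤ w x ∧ w x ≤ c) ∧ (∀ x y, |w x - w y| ≤ c / R * dist x y) ∧
      Integrable (fun x ↦ w x ^ 2) μ ∧ ∫ x, w x ^ 2 ∂μ = 1 ∧
      c ^ 2 * μ.real (Metric.ball p (4 * R)) ≤ D := by
  have hR0 : 0 < R := by linarith
  set B := Metric.ball p (4 * R) with hBdef
  set K := Metric.closedBall p (2 * R) with hKdef
  have hKB : K ⊆ B := Metric.closedBall_subset_ball (by linarith)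
  set f := ballCutoff p R with hf
  have hf0 : ∀ x, x ∉ K → f x = 0 := fun x hx ↦ ballCutoff_eq_zero hR0 hx
  have hfc : Continuous f := by
    rw [hf]; unfold ballCutoff; fun_prop
  have hbR : 0 < μ.real (Metric.ball p R) := ENNReal.toReal_pos hpos.ne'
    ((measure_mono (Metric.ball_subset_ball (by linarith))).trans_lt hfin).ne
  have hfsq := integrable_of_bound_of_eq_zero (μ := μ) (g := fun x ↦ f x ^ 2) (b := 1) hfin
    (hfc.pow 2).aestronglyMeasurable (fun x ↦ by
      rw [abs_of_nonneg (sq_nonneg _)]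
      exact pow_le_one₀ (ballCutoff_nonneg x) (ballCutoff_le_one x))
    (fun x hx ↦ by rw [hf0 x fun h ↦ hx (hKB h)]; simp)
  set N := ∫ x, f x ^ 2 ∂μ with hN
  have hNge : μ.real (Metric.ball p R) ≤ N := by
    have h1 : ∫ x in Metric.ball p R, f x ^ 2 ∂μ = μ.real (Metric.ball p R) := by
      rw [setIntegral_congr_fun (g := fun _ ↦ (1 : ℝ)) measurableSet_ball fun x hx ↦ by
        simp only [hf, ballCutoff_eq_one hR0 hx, one_pow]]
      simp
    rw [← h1]
    exact setIntegral_le_integral hfsq.1 (.of_forall fun x ↦ sq_nonneg _)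
  have hNpos : 0 < N := hbR.trans_le hNge
  -- Then `c² N = 1`, and `N ≥ vol(B_R)` turns the doubling hypothesis into `c² vol(B_{4R}) ≤ D c² N
  -- = D`.
  set c := (√N)⁻¹ with hc
  have hc0 : 0 ≤ c := by positivity
  have hcN : c ^ 2 * N = 1 := by
    rw [hc, inv_pow, Real.sq_sqrt hNpos.le, inv_mul_cancel₀ hNpos.ne']
  have hw2 : (fun x ↦ (c * f x) ^ 2) = fun x ↦ c ^ 2 * f x ^ 2 := by
    funext x
    rw [mul_pow]
  refine ⟨fun x ↦ c * f x, c, hc0, fun x hx ↦ by simp [hf0 x hx], fun x ↦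
    ⟨mul_nonneg hc0 (ballCutoff_nonneg x), mul_le_of_le_one_right hc0 (ballCutoff_le_one x)⟩,
    fun x y ↦ ?_, ?_, ?_, ?_⟩
  · rw [← mul_sub, abs_mul, abs_of_nonneg hc0, div_mul_eq_mul_div, ← mul_div_assoc']
    exact mul_le_mul_of_nonneg_left (abs_ballCutoff_sub_le hR0 x y) hc0
  · rw [hw2]
    exact hfsq.1.const_mul _
  · rw [hw2, integral_const_mul, hcN]
  · have hD0 : 0 ≤ D := by
      by_contra! h
      have : 0 ≤ μ.real B := measureReal_nonneg
      nlinarith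
    calc c ^ 2 * μ.real B ≤ c ^ 2 * (D * N) := by
          gcongr
          exact hD.trans (by gcongr)
      _ = D * (c ^ 2 * N) := by ring
      _ = D := by rw [hcN, mul_one]

theorem lambdaConst_nonneg {n : ℕ} {M : Type*} [MetricSpace M] [ChartedSpace (Model n) M]
    [RiemannianBundle (fun x : M ↦ TangentSpace (𝓡 n) x)] [MeasurableSpace M] {V : M → ℝ}
    (hV : ∀ x, 0 ≤ V x) : 0 ≤ lambdaConst n V := by
  refine le_sInf ?_
  rintro c ⟨u, X, -, -, -, rfl⟩
  exact EReal.coe_nonneg.2 (integral_nonneg fun x ↦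
    add_nonneg (by positivity) (mul_nonneg (hV x) (sq_nonneg _)))

theorem lambdaConst_le_integral {n : ℕ} {M : Type*} [MetricSpace M] [ChartedSpace (Model n) M]
    [RiemannianBundle (fun x : M ↦ TangentSpace (𝓡 n) x)] [MeasurableSpace M] {V w : M → ℝ}
    {X : ∀ x : M, TangentSpace (𝓡 n) x} (hw : IsH1 w X)
    (hw1 : ∫ x, w x ^ 2 ∂riemannianVolume n M = 1)
    (hV : Integrable (fun x ↦ V x * w x ^ 2) (riemannianVolume n M)) :
    lambdaConst n V ≤
      ((∫ x, (4 * ‖X x‖ ^ 2 + V x * w x ^ 2) ∂riemannianVolume n M : ℝ) : EReal) :=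
  sInf_le ⟨w, X, hw, hw1, hV, rfl⟩

variable {n : ℕ} {M : Type*} [MetricSpace M] [ChartedSpace (Model n) M]
  [RiemannianBundle (fun x : M ↦ TangentSpace (𝓡 n) x)] [IsManifold (𝓡 n) ∞ M]
  [IsContMDiffRiemannianBundle (𝓡 n) ∞ (Model n) (fun x : M ↦ TangentSpace (𝓡 n) x)]
  [IsRiemannianManifold (𝓡 n) M] [SecondCountableTopology M] [MeasurableSpace M] [BorelSpace M]

/-- The upper bound for `λ_V` given by the normalized cutoff function of a ball. -/
theorem lambdaConst_le_of_doubling [CompleteSpace M] {V u : M → ℝ}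
    (hu : ContMDiff (𝓡 n) 𝓘(ℝ, ℝ) ∞ u) (hV : IsLaplacian (n := n) u (fun x ↦ -V x))
    {G : ℝ} (hG : ∀ x : M, ‖grad (n := n) u x‖ ≤ G) {p : M} {R D : ℝ} (hR : 1 ≤ R)
    (hfin : riemannianVolume n M (Metric.ball p (4 * R)) < ⊤)
    (hD : (riemannianVolume n M).real (Metric.ball p (4 * R)) ≤
      D * (riemannianVolume n M).real (Metric.ball p R)) :
    lambdaConst n V ≤ ((D * (4 + 2 * G) / R : ℝ) : EReal) := by
  have hR0 : 0 < R := by linarith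
  have hG0 : 0 ≤ G := (norm_nonneg _).trans (hG p)
  have : ProperSpace M := properSpace n M
  obtain ⟨w, c, hc0, hw0, hwle, hwlip', hwint, hw1, hcv⟩ := exists_normalized_cutoff hR
    (riemannianVolume_pos_of_isOpen (n := n) Metric.isOpen_ball ⟨p, Metric.mem_ball_self hR0⟩)
    hfin hD
  -- The radius `4R` leaves room: off the open ball, a function supported in the closed `2R`-ball
  -- vanishes near each point, so its gradient vanishes too.
  have hKB : Metric.closedBall p (2 * R) ⊆ Metric.ball p (4 * R) :=
    Metric.closedBall_subset_ball (by linarith)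
  have hwlip : LipschitzWith (c / R).toNNReal w := by
    refine LipschitzWith.of_dist_le_mul fun x y ↦ ?_
    rw [Real.coe_toNNReal _ (by positivity), Real.dist_eq]
    exact hwlip' x y
  -- From `w(x)² - w(y)² = (w(x) + w(y)) (w(x) - w(y))` and `0 ≤ w ≤ c`.
  have hw2lip : LipschitzWith (2 * c ^ 2 / R).toNNReal (fun x ↦ w x ^ 2) := by
    refine LipschitzWith.of_dist_le_mul fun x y ↦ ?_
    rw [Real.coe_toNNReal _ (by positivity), Real.dist_eq, sq_sub_sq, abs_mul]
    have h1 : |w x + w y| ≤ 2 * c := by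
      rw [abs_of_nonneg (add_nonneg (hwle x).1 (hwle y).1)]
      linarith [(hwle x).2, (hwle y).2]
    calc |w x + w y| * |w x - w y| ≤ 2 * c * (c / R * dist x y) := by
          gcongr
          exact hwlip' x y
      _ = _ := by ring
  have hgw : ∀ x, ‖grad (n := n) w x‖ ≤ c / R := fun x ↦
    (norm_grad_le hwlip x).trans_eq (Real.coe_toNNReal _ (by positivity))
  have hgw2 : ∀ x, ‖grad (n := n) (fun x ↦ w x ^ 2) x‖ ≤ 2 * c ^ 2 / R := fun x ↦
    (norm_grad_le hw2lip x).trans_eq (Real.coe_toNNReal _ (by positivity))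
  have hgrad0 : ∀ g : M → ℝ, (∀ x, x ∉ Metric.closedBall p (2 * R) → g x = 0) →
      ∀ x, x ∉ Metric.ball p (4 * R) → grad (n := n) g x = 0 := by
    intro g hg x hx
    refine grad_eq_zero_of_eventuallyEq ?_
    filter_upwards [Metric.isClosed_closedBall.isOpen_compl.mem_nhds fun h ↦ hx (hKB h)] with z hz
      using hg z hz
  have hw20 : ∀ x, x ∉ Metric.closedBall p (2 * R) → w x ^ 2 = 0 := fun x hx ↦ by simp [hw0 x hx]
  have hXm : AEStronglyMeasurable (fun x ↦ ‖grad (n := n) w x‖ ^ 2) (riemannianVolume n M) :=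
    (aestronglyMeasurable_norm_grad w).pow 2
  have hXb : ∀ x, |‖grad (n := n) w x‖ ^ 2| ≤ (c / R) ^ 2 := fun x ↦ by
    rw [abs_of_nonneg (sq_nonneg _)]
    exact pow_le_pow_left₀ (norm_nonneg _) (hgw x) 2
  have hX0 : ∀ x, x ∉ Metric.ball p (4 * R) → ‖grad (n := n) w x‖ ^ 2 = 0 := fun x hx ↦ by
    rw [hgrad0 w hw0 x hx, norm_zero, zero_pow two_ne_zero]
  have hX := integrable_of_bound_of_eq_zero hfin hXm hXb hX0
  obtain ⟨hVint, hVeq⟩ := green_formula hu hV hw2lip (isCompact_closedBall p (2 * R)) hw20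
  have hIm := aestronglyMeasurable_inner_grad (n := n) u (fun x ↦ w x ^ 2)
  have hIb : ∀ x, |(inner ℝ (grad (n := n) u x) (grad (fun x ↦ w x ^ 2) x) : ℝ)| ≤
      G * (2 * c ^ 2 / R) := fun x ↦
    (abs_real_inner_le_norm _ _).trans (mul_le_mul (hG x) (hgw2 x) (norm_nonneg _) hG0)
  have hI0 : ∀ x, x ∉ Metric.ball p (4 * R) →
      (inner ℝ (grad (n := n) u x) (grad (fun x ↦ w x ^ 2) x) : ℝ) = 0 := fun x hx ↦ by
    rw [hgrad0 _ hw20 x hx, inner_zero_right]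
  have hVle := (integrable_of_bound_of_eq_zero hfin hIm hIb hI0).2
  have hmem : lambdaConst n V ≤
      ((∫ x, (4 * ‖grad (n := n) w x‖ ^ 2 + V x * w x ^ 2) ∂riemannianVolume n M : ℝ) : EReal) := by
    refine lambdaConst_le_integral ⟨?_, ?_, isWeakGradient_grad hwlip⟩ hw1 hVint
    · exact (memLp_two_iff_integrable_sq hwlip.continuous.aestronglyMeasurable).2 hwint
    · exact (memLp_two_iff_integrable_sq (aestronglyMeasurable_norm_grad w)).2 hX.1
  refine hmem.trans (EReal.coe_le_coe_iff.2 ?_)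
  rw [integral_add (hX.1.const_mul 4) hVint, integral_const_mul, hVeq]
  set v := (riemannianVolume n M).real (Metric.ball p (4 * R))
  have hcv0 : 0 ≤ c ^ 2 * v := by positivity
  calc _ ≤ 4 * ((c / R) ^ 2 * v) + G * (2 * c ^ 2 / R) * v := by
        gcongr
        exact hX.2
    _ = c ^ 2 * v * (4 / R) / R + c ^ 2 * v * (2 * G) / R := by field_simp
    -- The Dirichlet term decays like `1/R²`; since `R ≥ 1`, it is weakened to the `1/R` rate of the
    -- potential term.
    _ ≤ c ^ 2 * v * 4 / R + c ^ 2 * v * (2 * G) / R := by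
        gcongr
        exact div_le_self (by norm_num) hR
    _ = c ^ 2 * v * (4 + 2 * G) / R := by ring
    _ ≤ D * (4 + 2 * G) / R := by gcongr

theorem lambdaConst_nonpos [CompleteSpace M] (hVol : PolynomialVolumeGrowth n M) {V u : M → ℝ}
    (hu : ContMDiff (𝓡 n) 𝓘(ℝ, ℝ) ∞ u) (hV : IsLaplacian (n := n) u (fun x ↦ -V x))
    {G : ℝ} (hG : ∀ x : M, ‖grad (n := n) u x‖ ≤ G) : lambdaConst n V ≤ 0 := by
  obtain ⟨p, C, hC, k, hk, hvol⟩ := hVol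
  have hfin : ∀ R, 1 ≤ R → riemannianVolume n M (Metric.ball p R) < ⊤ := fun R hR ↦
    (hvol R hR).trans_lt ENNReal.ofReal_lt_top
  obtain ⟨D, hD, hdoub⟩ := exists_doubling_of_polynomial_growth
    (v := fun R ↦ (riemannianVolume n M).real (Metric.ball p R)) (C := C) (k := k)
    (fun R hR ↦ ENNReal.toReal_pos (riemannianVolume_pos_of_isOpen Metric.isOpen_ball
      ⟨p, Metric.mem_ball_self (by linarith)⟩).ne' (hfin R hR).ne)
    (fun R hR ↦ ENNReal.toReal_le_of_le_ofReal
      (mul_nonneg hC.le (Real.rpow_nonneg (by linarith) _)) (hvol R hR))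
  by_contra! hlt
  obtain ⟨r, hr0, hr⟩ := EReal.lt_iff_exists_real_btwn.1 hlt
  have hr0' : 0 < r := EReal.coe_pos.1 hr0
  -- A doubling scale beyond `D (4 + 2G) / r` gives `λ_V ≤ r`, against `r < λ_V`. The real `r`
  -- between avoids arithmetic with a possibly infinite `λ_V`.
  obtain ⟨R, hR1, hR, hle⟩ := hdoub (D * (4 + 2 * G) / r)
  have h1 := lambdaConst_le_of_doubling hu hV hG hR (hfin _ (by linarith)) hle
  have h2 : D * (4 + 2 * G) / R ≤ r := by
    rw [div_le_iff₀ hr0'] at hR1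
    rw [div_le_iff₀ (by linarith)]
    linarith
  exact absurd (hr.trans_le h1) (EReal.coe_le_coe_iff.2 h2).not_gt

end TestFunctions

end Riem

end

theorem theorem2 (n : ℕ) (M : Type*) [MetricSpace M] [SecondCountableTopology M]
    [MeasurableSpace M] [BorelSpace M]
    [ChartedSpace (EuclideanSpace ℝ (Fin n)) M] [IsManifold (𝓡 n) ∞ M]
    [RiemannianBundle (fun x : M ↦ TangentSpace (𝓡 n) x)]
    [IsContMDiffRiemannianBundle (𝓡 n) ∞ (EuclideanSpace ℝ (Fin n))
      (fun x : M ↦ TangentSpace (𝓡 n) x)]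
    [IsRiemannianManifold (𝓡 n) M]
    [CompleteSpace M] [NoncompactSpace M]
    (hRic : Riem.BoundedRicci n M)
    (hVol : Riem.PolynomialVolumeGrowth n M)
    (V u : M → ℝ) (hu : ContMDiff (𝓡 n) 𝓘(ℝ, ℝ) ∞ u)
    (hV : Riem.IsLaplacian (n := n) u (fun x ↦ -V x))
    (hgrad : ∃ C : ℝ, ∀ x : M, ‖Riem.grad (n := n) u x‖ ≤ C) :
    Riem.lambdaConst n V ≤ 0 ∧ ((∀ x, 0 ≤ V x) → Riem.lambdaConst n V = 0) := by
  obtain ⟨G, hG⟩ := hgrad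
  have h := Riem.lambdaConst_nonpos hVol hu hV hG
  exact ⟨h, fun hV0 ↦ le_antisymm h (Riem.lambdaConst_nonneg hV0)⟩
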